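/- Let $(A,\mathfrak m)$ be a Noetherian local ring with infinite residue field and let $J$ be an $\mathfrak m$-primary ideal of $A$. Let $\mathcal F=\{I_n\}_{n\ge 0}$ be a good filtration of ideals of $A$; that is, $I_0=A$, $I_1\ne A$, $I_{n+1}\subseteq I_n$ and $I_nI_m\subseteq I_{n+m}$ for all $n,m\ge 0$, and there is an ideal $I$ with $II_n\subseteq I_{n+1}$ for all $n\ge 0$ and $II_n=I_{n+1}$ for all large $n$ (such an $I$ is called a reduction of $\mathcal F$). Let $R(\mathcal F)=\bigoplus_{n\ge0}I_nt^n$, with maximal homogeneous ideal $\mathfrak M=\mathfrak m\oplus\bigoplus_{n>0}I_nt^n$, and for an $\mathfrak m$-primary ideal $K$ let $F_K(\mathcal F)=\bigoplus_{n\ge 0}(I_n/KI_n)t^n$ be the fiber cone of $\mathcal F$ with respect to $K$. Let $\ell=\dim F_{\mathfrak m}(\mathcal F)$ be the analytic spread of $\mathcal F$, and let $e(F_J(\mathcal F))$ denote the Hilbert–Samuel multiplicity of the local ring $F_J(\mathcal F)_{\mathfrak M}$, where the multiplicity of a Noetherian local ring $(R,\mathfrak n)$ of dimension $d$ is $\lim_{n\to\infty}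 d!\,\ell_R(R/\mathfrak n^n)/n^d$. For ideals $Q,I$ put $Q:I^\infty=\bigcup_{k\ge0}(Q:I^k)$, and let $\mathcal F/Q=\{I_n(A/Q)\}_{n\ge0}$. An element $x\in I_1$ is a weak-(FC)-element with respect to $(I,\mathcal F)$, where $I$ is an ideal and $\mathcal F$ is a good filtration that is not nilpotent (it is not the case that $I_n=0$ for all large $n$), if - there is $N$ such that $I^mI_n\cap(x)=I^m x I_{n-1}$ for all $n\ge N$ and all $m\ge 0$, and - $0:x\subseteq 0:I_1^\infty$. A sequence $x_1,\dots,x_s$ in $I_1$ is a weak-(FC)-sequence with respect to $(I,\mathcal F)$ if for each $0\le i<s$ the image of $x_{i+1}$ in $A_i=A/(x_1,\dots,x_i)$ is a weak-(FC)-element with respect to $(IA_i,\mathcal F/(x_1,\dots,x_i))$. Theorem 3.3. Assume $\ell>0$ and let $x_1,\dots,x_\ell$ be a weak-(FC)-sequence in $I_1$ with respect to $(J,\mathcal F)$. Set $\mathfrak I=(x_1,\dots,x_\ell)$ and $Q=(x_1,\dots,x_{\ell-1})$. Then $\mathfrak I$ is a reduction of $\mathcal F$, and if $r=r_{\mathfrak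 I}(\mathcal F)$ is its reduction number, i.e. the least integer $r\ge 0$ such that $\mathfrak I I_n=I_{n+1}$ for all $n\ge r$, then for all $n\ge r$ $$e(F_J(\mathcal F))=\ell_A\big(I_n/((Q:I_1^\infty)\cap I_n+JI_n)\big).$$ -/

import Mathlib

open Filter Topology IsLocalRing

noncomputable section

/-- A multiplicative filtration `I₀ ⊇ I₁ ⊇ I₂ ⊇ ⋯` of ideals of `A`, with `I₀ = A` and
`Iₙ Iₘ ⊆ Iₙ₊ₘ`.  The requirement that `I₁` is a proper ideal is part of `IdealFiltration.IsGood`. -/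
structure IdealFiltration (A : Type*) [CommRing A] where
  /-- the ideal `Iₙ` -/
  ideal : ℕ → Ideal A
  ideal_zero : ideal 0 = ⊤
  ideal_succ_le : ∀ n, ideal (n + 1) ≤ ideal n
  ideal_mul_le : ∀ n m, ideal n * ideal m ≤ ideal (n + m)

/-- The ideal `Q : I^∞ = ⋃ₖ (Q : Iᵏ)`. -/
def idealSaturation {A : Type*} [CommRing A] (Q I : Ideal A) : Ideal A where
  carrier := {a | ∃ k : ℕ, ∀ b ∈ I ^ k, a * b ∈ Q}
  zero_mem' := ⟨0, fun b _ => by simp⟩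
  add_mem' := by
    rintro a a' ⟨k, hk⟩ ⟨k', hk'⟩
    refine ⟨max k k', fun b hb => ?_⟩
    rw [add_mul]
    exact Q.add_mem (hk b (Ideal.pow_le_pow_right (le_max_left _ _) hb))
      (hk' b (Ideal.pow_le_pow_right (le_max_right _ _) hb))
  smul_mem' := by
    rintro c a ⟨k, hk⟩
    refine ⟨k, fun b hb => ?_⟩
    rw [smul_eq_mul, mul_assoc]
    exact Q.mul_mem_left c (hk b hb)

namespace IdealFiltration

variable {A : Type*} [CommRing A]

/-- `F` is `I`-good: `I Iₙ ⊆ Iₙ₊₁` for all `n`, with equality for all large `n`.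
One also says that `I` is a reduction of `F`. -/
def IsReduction (I : Ideal A) (F : IdealFiltration A) : Prop :=
  (∀ n, I * F.ideal n ≤ F.ideal (n + 1)) ∧
    ∃ N, ∀ n ≥ N, F.ideal (n + 1) = I * F.ideal n

/-- `F` is a good filtration: `I₁` is proper, and `F` is `I`-good for some ideal `I`. -/
def IsGood (F : IdealFiltration A) : Prop :=
  F.ideal 1 ≠ ⊤ ∧ ∃ I : Ideal A, IsReduction I F

/-- `Iₙ = 0` for all large `n`. -/
def IsNilpotent (F : IdealFiltration A) : Prop :=
  ∃ N, ∀ n ≥ N, F.ideal n = ⊥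

/-- The reduction number of `F` with respect to a reduction `I`: the least `r` such that
`I Iₙ = Iₙ₊₁` for all `n ≥ r`. -/
def reductionNumber (I : Ideal A) (F : IdealFiltration A) : ℕ :=
  sInf {r : ℕ | ∀ n ≥ r, I * F.ideal n = F.ideal (n + 1)}

/-- The filtration `F / Q = {Iₙ (A / Q)}` of `A / Q`. -/
def quotient (F : IdealFiltration A) (Q : Ideal A) : IdealFiltration (A ⧸ Q) where
  ideal n := (F.ideal n).map (Ideal.Quotient.mk Q)
  ideal_zero := by rw [F.ideal_zero, Ideal.map_top]
  ideal_succ_le n := Ideal.map_mono (F.ideal_succ_le n)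
  ideal_mul_le n m := by
    rw [← Ideal.map_mul]
    exact Ideal.map_mono (F.ideal_mul_le n m)

/-- `x` is a weak-(FC)-element with respect to `(I, F)`, where `F` is a non-nilpotent good
filtration and `x ∈ I₁`.
(FC₁): `Iᵐ Iₙ ∩ (x) = Iᵐ x Iₙ₋₁` for all large `n` and all `m ≥ 0` (written for `n + 1`).
(FC₂): `x` is filter-regular with respect to `I₁`, i.e. `0 : x ⊆ 0 : I₁^∞`. -/
structure IsWeakFCElement (I : Ideal A) (F : IdealFiltration A) (x : A) : Prop where
  good : F.IsGood
  not_nilpotent : ¬ F.IsNilpotent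
  mem : x ∈ F.ideal 1
  fc_one : ∃ N, ∀ n ≥ N, ∀ m : ℕ,
    (I ^ m * F.ideal (n + 1)) ⊓ Ideal.span {x} = I ^ m * (Ideal.span {x} * F.ideal n)
  fc_two : ∀ y : A, x * y = 0 → y ∈ idealSaturation ⊥ (F.ideal 1)

/-- The ideal `(x₁, …, xᵢ)` generated by the first `i` members of a finite sequence. -/
def initialIdeal {s : ℕ} (x : Fin s → A) (i : ℕ) : Ideal A :=
  Ideal.span (x '' {j : Fin s | (j : ℕ) < i})

/-- `x₁, …, xₛ` is a weak-(FC)-sequence in `I₁` with respect to `(I, F)`: all `xᵢ` lie in `I₁`, and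
for `0 ≤ i < s` the image of `xᵢ₊₁` in `Aᵢ = A / (x₁, …, xᵢ)` is a weak-(FC)-element with respect
to `(I Aᵢ, F / (x₁, …, xᵢ))`.  (The member `xᵢ₊₁` is `x i`, as `Fin s` starts at `0`.) -/
def IsWeakFCSequence (I : Ideal A) (F : IdealFiltration A) {s : ℕ} (x : Fin s → A) : Prop :=
  (∀ i, x i ∈ F.ideal 1) ∧
    ∀ i : Fin s,
      IsWeakFCElement (I.map (Ideal.Quotient.mk (initialIdeal x i)))
        (F.quotient (initialIdeal x i)) (Ideal.Quotient.mk (initialIdeal x i) (x i))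

/-- The Rees algebra `R(F) = ⨁ₙ Iₙ tⁿ`, as a subalgebra of `A[t]`. -/
def rees (F : IdealFiltration A) : Subalgebra A (Polynomial A) where
  carrier := {f | ∀ n, f.coeff n ∈ F.ideal n}
  mul_mem' := by
    intro f g hf hg n
    rw [Polynomial.coeff_mul]
    refine Ideal.sum_mem _ fun p hp => ?_
    have h := F.ideal_mul_le p.1 p.2 (Ideal.mul_mem_mul (hf p.1) (hg p.2))
    rwa [Finset.HasAntidiagonal.mem_antidiagonal.mp hp] at h
  add_mem' := by
    intro f g hf hg n
    rw [Polynomial.coeff_add]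
    exact Ideal.add_mem _ (hf n) (hg n)
  algebraMap_mem' := by
    intro a n
    rw [Polynomial.algebraMap_apply, Polynomial.coeff_C]
    split_ifs with h
    · subst h
      rw [F.ideal_zero]
      trivial
    · exact Ideal.zero_mem _

/-- The ideal `⨁ₙ J Iₙ tⁿ` of the Rees algebra `R(F)`. -/
def fiberIdeal (J : Ideal A) (F : IdealFiltration A) : Ideal F.rees where
  carrier := {f | ∀ n, (f : Polynomial A).coeff n ∈ J * F.ideal n}
  zero_mem' := fun n => by simp
  add_mem' := by
    intro f g hf hg n
    simpa using Ideal.add_mem _ (hf n) (hg n)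
  smul_mem' := by
    intro c f hf n
    rw [smul_eq_mul, MulMemClass.coe_mul, Polynomial.coeff_mul]
    refine Ideal.sum_mem _ fun p hp => ?_
    have h := Ideal.mul_mem_mul (c.2 p.1) (hf p.2)
    rw [mul_left_comm] at h
    have h' := Ideal.mul_mono_right (I := J) (F.ideal_mul_le p.1 p.2) h
    rwa [Finset.HasAntidiagonal.mem_antidiagonal.mp hp] at h'

theorem mem_fiberIdeal (J : Ideal A) (F : IdealFiltration A) (f : F.rees) :
    f ∈ fiberIdeal J F ↔ ∀ n, (f : Polynomial A).coeff n ∈ J * F.ideal n :=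
  Iff.rfl

/-- The fiber cone `F_J(F) = ⨁ₙ (Iₙ / J Iₙ) tⁿ`, i.e. `(⨁ₙ Iₙ tⁿ) / (⨁ₙ J Iₙ tⁿ)`. -/
def FiberCone (J : Ideal A) (F : IdealFiltration A) : Type _ :=
  F.rees ⧸ fiberIdeal J F

instance (J : Ideal A) (F : IdealFiltration A) : CommRing (FiberCone J F) :=
  Ideal.Quotient.commRing (fiberIdeal J F)

/-- The projection `R(F) → F_J(F)`. -/
def toFiberCone (J : Ideal A) (F : IdealFiltration A) : F.rees →+* FiberCone J F :=
  Ideal.Quotient.mk (fiberIdeal J F)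

theorem toFiberCone_surjective (J : Ideal A) (F : IdealFiltration A) :
    Function.Surjective (toFiberCone J F) :=
  Ideal.Quotient.mk_surjective

theorem ker_toFiberCone (J : Ideal A) (F : IdealFiltration A) :
    RingHom.ker (toFiberCone J F) = fiberIdeal J F :=
  Ideal.mk_ker

variable [IsLocalRing A]

/-- The analytic spread of `F`: the Krull dimension of the fiber cone of `F` with respect to the
maximal ideal of `A`. -/
def analyticSpread (F : IdealFiltration A) : WithBot ℕ∞ :=
  ringKrullDim (FiberCone (maximalIdeal A) F)

/-- The ring homomorphism from `R(F)` to the residue field of `A` given by the residue of the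
constant coefficient. -/
def reesResidue (F : IdealFiltration A) : F.rees →+* ResidueField A :=
  (residue A).comp (Polynomial.constantCoeff.comp F.rees.val.toRingHom)

/-- The maximal homogeneous ideal `𝔐 = 𝔪 ⊕ ⨁_{n > 0} Iₙ tⁿ` of `R(F)`. -/
def reesMaximalIdeal (F : IdealFiltration A) : Ideal F.rees :=
  RingHom.ker F.reesResidue

theorem mem_reesMaximalIdeal (F : IdealFiltration A) (f : F.rees) :
    f ∈ F.reesMaximalIdeal ↔ (f : Polynomial A).coeff 0 ∈ maximalIdeal A := by
  simp [reesMaximalIdeal, reesResidue, RingHom.mem_ker]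

/-- The maximal homogeneous ideal of the fiber cone, the image of `𝔐`. -/
def fiberMaximalIdeal (J : Ideal A) (F : IdealFiltration A) : Ideal (FiberCone J F) :=
  F.reesMaximalIdeal.map (toFiberCone J F)

theorem fiberMaximalIdeal_isPrime {J : Ideal A} (hJ : J.radical = maximalIdeal A)
    (F : IdealFiltration A) : (fiberMaximalIdeal J F).IsPrime := by
  have : F.reesMaximalIdeal.IsPrime := RingHom.ker_isPrime _
  refine Ideal.map_isPrime_of_surjective (toFiberCone_surjective J F) ?_
  rw [ker_toFiberCone]
  intro f hf
  rw [mem_fiberIdeal] at hf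
  have h0 : (f : Polynomial A).coeff 0 ∈ J := Ideal.mul_le_left (hf 0)
  rw [mem_reesMaximalIdeal, ← hJ]
  exact Ideal.le_radical h0

/-- The local ring `F_J(F)_𝔐`, for an ideal `J` whose radical is the maximal ideal of `A`. -/
abbrev LocalFiberCone {J : Ideal A} (hJ : J.radical = maximalIdeal A)
    (F : IdealFiltration A) : Type _ :=
  haveI := fiberMaximalIdeal_isPrime hJ F
  Localization.AtPrime (fiberMaximalIdeal J F)

instance {J : Ideal A} (hJ : J.radical = maximalIdeal A) (F : IdealFiltration A) :
    IsLocalRing (LocalFiberCone hJ F) :=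
  haveI := fiberMaximalIdeal_isPrime hJ F
  Localization.AtPrime.isLocalRing (fiberMaximalIdeal J F)

end IdealFiltration

/-- `e` is the Hilbert–Samuel multiplicity of the local ring `R` with maximal ideal `𝔫`: the Krull
dimension `d` of `R` is finite, all `R / 𝔫ⁿ` have finite length, and
`e = lim_{n → ∞} d! · length (R / 𝔫ⁿ) / nᵈ`. -/
def HasHilbertSamuelMultiplicity (R : Type*) [CommRing R] [IsLocalRing R] (e : ℕ) : Prop :=
  ∃ d : ℕ, ringKrullDim R = (d : WithBot ℕ∞) ∧
    (∀ n : ℕ, Module.length R (R ⧸ maximalIdeal R ^ n) ≠ ⊤) ∧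
    Tendsto (fun n : ℕ =>
        ((d.factorial : ℝ) * ((Module.length R (R ⧸ maximalIdeal R ^ n)).toNat : ℝ)) / (n : ℝ) ^ d)
      atTop (𝓝 (e : ℝ))

theorem HasHilbertSamuelMultiplicity.unique {R : Type*} [CommRing R] [IsLocalRing R] {e e' : ℕ}
    (h : HasHilbertSamuelMultiplicity R e) (h' : HasHilbertSamuelMultiplicity R e') : e = e' := by
  obtain ⟨d, hd, -, ht⟩ := h
  obtain ⟨d', hd', -, ht'⟩ := h'
  obtain rfl : d = d' := by
    have := hd.symm.trans hd'
    exact_mod_cast this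
  exact_mod_cast tendsto_nhds_unique ht ht'

end

/-!
Everything is transported to the ring `A` and to the Rees algebra `R(F)`. For an ideal `P` write
`G(P) = ⨁ₙ Iₙ / (P ∩ Iₙ + J Iₙ)`, the fiber cone of `F / P`, a quotient of `R(F)`
(`fiberIdealModulo`), and let `h P n` (`fiberLength`) be the length of its part of degree `n`. Put
`Qᵢ = (x₁, …, xᵢ)`.

The key fact is that `x = xᵢ₊₁` acts injectively on `G(Qᵢ)` in large degrees
(`IsWeakFCModulo.exists_mem_of_mul_mem`). Indeed (FC₁) with `m = 1` reduces this to elements of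
`(Qᵢ : x) ∩ Iₙ`, which lie in `(Qᵢ : I₁^∞) ∩ Iₙ` by (FC₂), and for large `n` the latter is contained
in `Qᵢ` by the Artin–Rees lemma (`exists_idealSaturation_inf_le`). There are three consequences.

* Elements of `G(Qᵢ)` killed by a power of `x t` are nilpotent, so `x t` lies in no minimal prime of
  `G(Qᵢ)` (`IsWeakFCModulo.exists_prime_lt`). Chains of primes below the maximal homogeneous ideal
  thus grow by one step when passing from `Qᵢ₊₁` to `Qᵢ`. As the fiber cone has dimension `ℓ`, its
  localization has dimension `ℓ` and `G(Q_ℓ)` is zero-dimensional at its maximal homogeneous ideal,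
  whence `Iₙ ⊆ Q_ℓ` for large `n`. Together with (FC₁) for `m = 0` this makes `Q_ℓ` a reduction
  (`IsWeakFCSequence.isReduction`).
* `h Qᵢ (n + 1) - h Qᵢ n = h Qᵢ₊₁ (n + 1)` for large `n`
  (`IsWeakFCModulo.exists_fiberLength_succ`).
* With `Q = Q_{ℓ-1}`, the values `h Q n` and `h (Q : I₁^∞) n` agree for large `n`, and the latter
  is constant from the reduction number on, as there `x_ℓ` is a nonzerodivisor modulo `Q : I₁^∞`
  and maps `Iₙ` onto `Iₙ₊₁` modulo `Q : I₁^∞` (`IsWeakFCModulo.fiberLength_saturation_succ`).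

If `e` is this constant, summing up `ℓ - 1` times shows that `h 0 n` grows like
`e n ^ (ℓ - 1) / (ℓ - 1)!`. Powers of the maximal homogeneous ideal of the fiber cone and the
ideals of elements of order at least `n` are cofinal with a bounded shift
(`exists_reesMaximalIdeal_pow_le`), so one more summation identifies `e` with the Hilbert–Samuel
multiplicity.
-/

/-! ### Filtrations and weak-(FC)-elements modulo an ideal -/

namespace IdealFiltration

variable {A : Type*} [CommRing A]

theorem antitone_ideal (F : IdealFiltration A) : Antitone F.ideal :=
  antitone_nat_of_succ_le F.ideal_succ_le

theorem pow_mem_ideal (F : IdealFiltration A) {a : A} {n : ℕ} (ha : a ∈ F.ideal n) (k : ℕ) :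
    a ^ k ∈ F.ideal (n * k) := by
  induction k with
  | zero => simp [F.ideal_zero]
  | succ k ih =>
    rw [pow_succ, mul_add_one]
    exact F.ideal_mul_le _ _ (Ideal.mul_mem_mul ih ha)

theorem IsReduction.le_ideal_one {I : Ideal A} {F : IdealFiltration A} (hI : IsReduction I F) :
    I ≤ F.ideal 1 := by
  simpa [F.ideal_zero] using hI.1 0

/-- Past the stable range, `F` is the `I`-adic filtration shifted by `N`. -/
theorem IsReduction.exists_ideal_add {I : Ideal A} {F : IdealFiltration A}
    (hI : IsReduction I F) : ∃ N, ∀ k, F.ideal (N + k) = I ^ k * F.ideal N := by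
  obtain ⟨N, hN⟩ := hI.2
  refine ⟨N, fun k => ?_⟩
  induction k with
  | zero => simp
  | succ k ih => rw [← add_assoc, hN _ (Nat.le_add_right N k), ih, pow_succ', mul_assoc]

theorem le_idealSaturation (P I : Ideal A) : P ≤ idealSaturation P I :=
  fun _ ha => ⟨0, fun b _ => P.mul_mem_right b ha⟩

/-- In a Noetherian ring one exponent works for the whole saturation. -/
theorem exists_idealSaturation_mul_pow_le [IsNoetherianRing A] (P I : Ideal A) :
    ∃ k : ℕ, idealSaturation P I * I ^ k ≤ P := by
  have key : ∀ L : Ideal A, L.FG → L ≤ idealSaturation P I → ∃ k : ℕ, L * I ^ k ≤ P := by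
    intro L hL
    induction L, hL using Submodule.fg_induction with
    | singleton a =>
      intro h
      obtain ⟨k, hk⟩ := h (Submodule.mem_span_singleton_self a)
      refine ⟨k, ?_⟩
      change Ideal.span {a} * I ^ k ≤ P
      rw [Ideal.span_singleton_mul_le_iff]
      exact hk
    | sup L₁ L₂ _ _ h₁ h₂ =>
      intro h
      obtain ⟨k₁, hk₁⟩ := h₁ (le_sup_left.trans h)
      obtain ⟨k₂, hk₂⟩ := h₂ (le_sup_right.trans h)
      refine ⟨max k₁ k₂, ?_⟩
      change (L₁ ⊔ L₂) * I ^ max k₁ k₂ ≤ P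
      rw [Ideal.sup_mul]
      exact sup_le
        ((Ideal.mul_mono_right (Ideal.pow_le_pow_right (le_max_left _ _))).trans hk₁)
        ((Ideal.mul_mono_right (Ideal.pow_le_pow_right (le_max_right _ _))).trans hk₂)
  exact key _ (IsNoetherian.noetherian _) le_rfl

/-- By the Artin–Rees lemma, `(P : I₁^∞) ∩ Iₙ ⊆ P` for all large `n`: a large power of a reduction
of `F` can be split off the intersection, and it carries `P : I₁^∞` into `P`. -/
theorem exists_idealSaturation_inf_le [IsNoetherianRing A] {F : IdealFiltration A}
    (hF : F.IsGood) (P : Ideal A) :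
    ∃ N, ∀ n ≥ N, idealSaturation P (F.ideal 1) ⊓ F.ideal n ≤ P := by
  obtain ⟨-, I, hI⟩ := hF
  obtain ⟨N, hN⟩ := hI.exists_ideal_add
  obtain ⟨k, hk⟩ := exists_idealSaturation_mul_pow_le P (F.ideal 1)
  obtain ⟨c, hc⟩ := Ideal.exists_pow_inf_eq_pow_smul (M := A) I (idealSaturation P (F.ideal 1))
  refine ⟨N + c + k, fun n hn => ?_⟩
  obtain ⟨j, rfl⟩ : ∃ j, n = N + (c + k + j) := ⟨n - (N + c + k), by omega⟩
  have h1 := hc (c + k + j) (by omega)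
  simp only [smul_eq_mul, Ideal.mul_top] at h1
  calc idealSaturation P (F.ideal 1) ⊓ F.ideal (N + (c + k + j))
      ≤ I ^ (c + k + j) ⊓ idealSaturation P (F.ideal 1) := by
        rw [inf_comm, hN]
        exact inf_le_inf_right _ Ideal.mul_le_left
    _ = I ^ (c + k + j - c) * (I ^ c ⊓ idealSaturation P (F.ideal 1)) := h1
    _ ≤ F.ideal 1 ^ k * idealSaturation P (F.ideal 1) := by
        refine Ideal.mul_mono ?_ inf_le_right
        exact (Ideal.pow_le_pow_right (by omega)).trans (Ideal.pow_right_mono hI.le_ideal_one k)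
    _ ≤ P := by rwa [mul_comm]

/-- Nakayama's lemma for the members of a filtration, modulo an ideal `P`. -/
theorem ideal_le_of_le_sup_mul [IsLocalRing A] [IsNoetherianRing A] {J : Ideal A}
    (hJ : J ≤ maximalIdeal A) {F : IdealFiltration A} {P : Ideal A} {n : ℕ}
    (h : F.ideal n ≤ P ⊔ J * F.ideal n) : F.ideal n ≤ P := by
  refine Submodule.le_of_le_smul_of_le_jacobson_bot (I := J) (IsNoetherian.noetherian _) ?_ h
  rwa [IsLocalRing.jacobson_eq_maximalIdeal ⊥ bot_ne_top]

/-- The conditions on `x` for its image in `A / P` to be a weak-(FC)-element with respect to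
`(J (A / P), F / P)`, written with ideals of `A`. -/
structure IsWeakFCModulo (J : Ideal A) (F : IdealFiltration A) (P : Ideal A) (x : A) : Prop where
  mem : x ∈ F.ideal 1
  not_le : ∀ n, ¬ F.ideal n ≤ P
  inf_le : ∃ N, ∀ n ≥ N, ∀ m : ℕ,
    (J ^ m * F.ideal (n + 1) ⊔ P) ⊓ (Ideal.span {x} ⊔ P) ≤
      J ^ m * (Ideal.span {x} * F.ideal n) ⊔ P
  mem_saturation : ∀ y, x * y ∈ P → y ∈ idealSaturation P (F.ideal 1)

theorem IsWeakFCElement.modulo {J : Ideal A} {F : IdealFiltration A} {P : Ideal A} {x : A}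
    (hx : x ∈ F.ideal 1)
    (h : IsWeakFCElement (J.map (Ideal.Quotient.mk P)) (F.quotient P) (Ideal.Quotient.mk P x)) :
    IsWeakFCModulo J F P x where
  mem := hx
  not_le n hn := by
    refine h.not_nilpotent ⟨n, fun m hm => ?_⟩
    change (F.ideal m).map (Ideal.Quotient.mk P) = ⊥
    rw [Ideal.map_eq_bot_iff_le_ker, Ideal.mk_ker]
    exact (F.antitone_ideal hm).trans hn
  inf_le := by
    obtain ⟨N, hN⟩ := h.fc_one
    refine ⟨N, fun n hn m => ?_⟩
    have h1 := congrArg (Ideal.comap (Ideal.Quotient.mk P)) (hN n hn m)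
    simp only [quotient, ← Ideal.map_pow, ← Ideal.map_mul, ← Set.image_singleton (a := x),
      ← Ideal.map_span, Ideal.comap_inf,
      Ideal.comap_map_of_surjective _ Ideal.Quotient.mk_surjective, ← RingHom.ker_eq_comap_bot,
      Ideal.mk_ker] at h1
    exact h1.le
  mem_saturation y hy := by
    obtain ⟨k, hk⟩ := h.fc_two (Ideal.Quotient.mk P y) (by
      rw [← map_mul]; exact Ideal.Quotient.eq_zero_iff_mem.mpr hy)
    refine ⟨k, fun b hb => ?_⟩
    have h1 := hk (Ideal.Quotient.mk P b) (by
      change _ ∈ ((F.ideal 1).map (Ideal.Quotient.mk P)) ^ k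
      rw [← Ideal.map_pow]; exact Ideal.mem_map_of_mem _ hb)
    rwa [← map_mul, Ideal.mem_bot, Ideal.Quotient.eq_zero_iff_mem] at h1

section InitialIdeal

variable {s : ℕ} (x : Fin s → A)

theorem initialIdeal_zero : initialIdeal x 0 = ⊥ := by simp [initialIdeal]

theorem initialIdeal_succ (i : Fin s) :
    initialIdeal x (i + 1) = initialIdeal x i ⊔ Ideal.span {x i} := by
  have : {j : Fin s | (j : ℕ) < i + 1} = {j : Fin s | (j : ℕ) < i} ∪ {i} := by
    ext j
    simp only [Set.mem_ofPred_eq, Set.mem_union, Set.mem_singleton_iff, Fin.ext_iff]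
    omega
  rw [initialIdeal, this, Set.image_union, Set.image_singleton, Ideal.span_union, initialIdeal]

theorem initialIdeal_self : initialIdeal x s = Ideal.span (Set.range x) := by
  simp [initialIdeal]

theorem initialIdeal_le {I : Ideal A} (hx : ∀ i, x i ∈ I) (i : ℕ) : initialIdeal x i ≤ I := by
  rw [initialIdeal, Ideal.span_le]
  rintro _ ⟨j, -, rfl⟩
  exact hx j

end InitialIdeal

theorem IsWeakFCSequence.modulo {J : Ideal A} {F : IdealFiltration A} {s : ℕ} {x : Fin s → A}
    (h : IsWeakFCSequence J F x) (i : Fin s) : IsWeakFCModulo J F (initialIdeal x i) (x i) :=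
  (h.2 i).modulo (h.1 i)

namespace IsWeakFCModulo

variable {J : Ideal A} {F : IdealFiltration A} {P : Ideal A} {x : A}

/-- `x` acts injectively on `⨁ₙ Iₙ / (P ∩ Iₙ + J Iₙ)` in large degrees. -/
theorem exists_mem_of_mul_mem [IsNoetherianRing A] (h : IsWeakFCModulo J F P x) (hF : F.IsGood) :
    ∃ N, ∀ n ≥ N, ∀ y ∈ F.ideal n, x * y ∈ P ⊔ J * F.ideal (n + 1) → y ∈ P ⊔ J * F.ideal n := by
  obtain ⟨N₁, h₁⟩ := h.inf_le
  obtain ⟨N₂, h₂⟩ := exists_idealSaturation_inf_le hF P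
  refine ⟨max N₁ N₂, fun n hn y hy hxy => ?_⟩
  have h3 := h₁ n (le_of_max_le_left hn) 1 ⟨by rwa [pow_one, sup_comm],
    Ideal.mem_sup_left (Ideal.mul_mem_right y _ (Ideal.mem_span_singleton_self x))⟩
  rw [pow_one, mul_left_comm] at h3
  obtain ⟨a, ha, p, hp, hap⟩ := Submodule.mem_sup.mp h3
  obtain ⟨w, hw, rfl⟩ := Ideal.mem_span_singleton_mul.mp ha
  have h4 : y - w ∈ P := by
    refine h₂ n (le_of_max_le_right hn) ⟨h.mem_saturation _ ?_, ?_⟩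
    · rwa [mul_sub, ← hap, add_sub_cancel_left]
    · exact Ideal.sub_mem _ hy (Ideal.mul_le_right hw)
  rw [← sub_add_cancel y w]
  exact Ideal.add_mem _ (Ideal.mem_sup_left h4) (Ideal.mem_sup_right hw)

theorem exists_mem_of_pow_mul_mem [IsNoetherianRing A] (h : IsWeakFCModulo J F P x)
    (hF : F.IsGood) :
    ∃ N, ∀ n ≥ N, ∀ k, ∀ y ∈ F.ideal n, x ^ k * y ∈ P ⊔ J * F.ideal (n + k) →
      y ∈ P ⊔ J * F.ideal n := by
  obtain ⟨N, hN⟩ := h.exists_mem_of_mul_mem hF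
  refine ⟨N, fun n hn k => ?_⟩
  induction k with
  | zero => intro y _ hxy; simpa using hxy
  | succ k ih =>
    intro y hy hxy
    refine ih y hy (hN (n + k) (by omega) _ ?_ ?_)
    · rw [add_comm n k]
      refine F.ideal_mul_le k n (Ideal.mul_mem_mul ?_ hy)
      simpa using F.pow_mem_ideal h.mem k
    · rwa [← mul_assoc, ← pow_succ']

theorem sup_inf_le (h : IsWeakFCModulo J F P x) :
    ∃ N, ∀ n ≥ N, (P ⊔ Ideal.span {x}) ⊓ F.ideal (n + 1) ≤ P ⊔ Ideal.span {x} * F.ideal n := by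
  obtain ⟨N, hN⟩ := h.inf_le
  refine ⟨N, fun n hn y hy => ?_⟩
  have h1 := hN n hn 0 ⟨by rw [pow_zero, one_mul]; exact Ideal.mem_sup_left hy.2, by
    rw [sup_comm]; exact hy.1⟩
  rwa [pow_zero, one_mul, sup_comm] at h1

end IsWeakFCModulo

/-- `Qᵢ ∩ Iₙ₊₁ ⊆ Qᵢ Iₙ` for large `n`, where `Qᵢ` is generated by an initial part of a
weak-(FC)-sequence. -/
theorem IsWeakFCSequence.initialIdeal_inf_le {J : Ideal A} {F : IdealFiltration A} {s : ℕ}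
    {x : Fin s → A} (h : IsWeakFCSequence J F x) (i : ℕ) (hi : i ≤ s) :
    ∃ N, ∀ n ≥ N, initialIdeal x i ⊓ F.ideal (n + 1) ≤ initialIdeal x i * F.ideal n := by
  induction i with
  | zero => exact ⟨0, fun n _ => by simp [initialIdeal_zero]⟩
  | succ i ih =>
    obtain ⟨N₁, h₁⟩ := ih (by omega)
    obtain ⟨N₂, h₂⟩ := (h.modulo ⟨i, hi⟩).sup_inf_le
    refine ⟨max N₁ N₂, fun n hn => ?_⟩
    have e := initialIdeal_succ x ⟨i, hi⟩
    simp only at e h₂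
    rw [e]
    have hle : Ideal.span {x ⟨i, hi⟩} * F.ideal n ≤ F.ideal (n + 1) := by
      refine (Ideal.mul_mono_left ((Ideal.span_singleton_le_iff_mem _).mpr (h.1 _))).trans ?_
      rw [add_comm n 1]
      exact F.ideal_mul_le 1 n
    calc (initialIdeal x i ⊔ Ideal.span {x ⟨i, hi⟩}) ⊓ F.ideal (n + 1)
        ≤ (initialIdeal x i ⊔ Ideal.span {x ⟨i, hi⟩} * F.ideal n) ⊓ F.ideal (n + 1) :=
          le_inf (h₂ n (le_of_max_le_right hn)) inf_le_right
      _ = (initialIdeal x i ⊓ F.ideal (n + 1)) ⊔ Ideal.span {x ⟨i, hi⟩} * F.ideal n := by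
          rw [sup_comm, sup_inf_assoc_of_le _ hle, sup_comm]
      _ ≤ initialIdeal x i * F.ideal n ⊔ Ideal.span {x ⟨i, hi⟩} * F.ideal n :=
          sup_le_sup_right (h₁ n (le_of_max_le_left hn)) _
      _ = _ := (Ideal.sup_mul _ _ _).symm

end IdealFiltration

/-! ### Primes of the Rees algebra -/

namespace IdealFiltration

variable {A : Type*} [CommRing A]

/-- The homogeneous element `a tⁿ` of the Rees algebra, for `a ∈ Iₙ`. -/
noncomputable def reesMonomial (F : IdealFiltration A) (n : ℕ) : F.ideal n →ₗ[A] F.rees where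
  toFun a := ⟨Polynomial.monomial n (a : A), fun m => by
    rw [Polynomial.coeff_monomial]
    split_ifs with h
    · exact h ▸ a.2
    · exact Ideal.zero_mem _⟩
  map_add' a b := Subtype.ext (by simp)
  map_smul' c a := Subtype.ext (by simp [Polynomial.smul_monomial])

@[simp]
theorem coe_reesMonomial (F : IdealFiltration A) (n : ℕ) (a : F.ideal n) :
    (F.reesMonomial n a : Polynomial A) = Polynomial.monomial n (a : A) :=
  rfl

theorem reesMonomial_mul (F : IdealFiltration A) {n m : ℕ} {a b : A} (ha : a ∈ F.ideal n)
    (hb : b ∈ F.ideal m) :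
    F.reesMonomial n ⟨a, ha⟩ * F.reesMonomial m ⟨b, hb⟩ =
      F.reesMonomial (n + m) ⟨a * b, F.ideal_mul_le n m (Ideal.mul_mem_mul ha hb)⟩ :=
  Subtype.ext (by simp [Polynomial.monomial_mul_monomial])

theorem reesMonomial_pow (F : IdealFiltration A) {n : ℕ} {a : A} (ha : a ∈ F.ideal n) (k : ℕ) :
    F.reesMonomial n ⟨a, ha⟩ ^ k = F.reesMonomial (n * k) ⟨a ^ k, F.pow_mem_ideal ha k⟩ :=
  Subtype.ext (by simp [Polynomial.monomial_pow])

theorem sum_reesMonomial (F : IdealFiltration A) (f : F.rees) :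
    f = ∑ n ∈ Finset.range ((f : Polynomial A).natDegree + 1),
      F.reesMonomial n ⟨(f : Polynomial A).coeff n, f.2 n⟩ := by
  refine Subtype.ext ?_
  rw [AddSubmonoidClass.coe_finsetSum]
  exact Polynomial.as_sum_range _

/-- An ideal of the Rees algebra containing the homogeneous components of `f` contains `f`. -/
theorem mem_of_forall_reesMonomial_mem (F : IdealFiltration A) {K : Ideal F.rees} (f : F.rees)
    (h : ∀ n, F.reesMonomial n ⟨(f : Polynomial A).coeff n, f.2 n⟩ ∈ K) : f ∈ K := by
  rw [F.sum_reesMonomial f]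
  exact K.sum_mem fun n _ => h n

/-- The ideal `⨁ₙ (P ∩ Iₙ + J Iₙ) tⁿ` of the Rees algebra; the quotient by it is the fiber cone of
`F / P` with respect to `J (A / P)`. As the coefficient of `tⁿ` lies in `Iₙ` and `J Iₙ ⊆ Iₙ`, the
intersection with `Iₙ` need not be mentioned. -/
def fiberIdealModulo (J : Ideal A) (F : IdealFiltration A) (P : Ideal A) : Ideal F.rees where
  carrier := {f | ∀ n, (f : Polynomial A).coeff n ∈ P ⊔ J * F.ideal n}
  zero_mem' := fun n => by simp
  add_mem' := by
    intro f g hf hg n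
    simpa using Ideal.add_mem _ (hf n) (hg n)
  smul_mem' := by
    intro c f hf n
    rw [smul_eq_mul, MulMemClass.coe_mul, Polynomial.coeff_mul]
    refine Ideal.sum_mem _ fun p hp => ?_
    obtain ⟨a, ha, b, hb, hab⟩ := Submodule.mem_sup.mp (hf p.2)
    rw [← hab, mul_add]
    refine Submodule.add_mem_sup (P.mul_mem_left _ ha) ?_
    have h := Ideal.mul_mem_mul (c.2 p.1) hb
    rw [mul_left_comm] at h
    have h' := Ideal.mul_mono_right (I := J) (F.ideal_mul_le p.1 p.2) h
    rwa [Finset.HasAntidiagonal.mem_antidiagonal.mp hp] at h'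

theorem mem_fiberIdealModulo {J : Ideal A} {F : IdealFiltration A} {P : Ideal A} {f : F.rees} :
    f ∈ fiberIdealModulo J F P ↔ ∀ n, (f : Polynomial A).coeff n ∈ P ⊔ J * F.ideal n :=
  Iff.rfl

theorem fiberIdealModulo_bot (J : Ideal A) (F : IdealFiltration A) :
    fiberIdealModulo J F ⊥ = fiberIdeal J F := by
  ext f
  simp [mem_fiberIdealModulo, mem_fiberIdeal]

theorem fiberIdealModulo_mono (J : Ideal A) (F : IdealFiltration A) {P P' : Ideal A} (h : P ≤ P') :
    fiberIdealModulo J F P ≤ fiberIdealModulo J F P' :=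
  fun _ hf n => sup_le_sup_right h _ (hf n)

theorem reesMonomial_mem_fiberIdealModulo {J : Ideal A} {F : IdealFiltration A} {P : Ideal A}
    {n : ℕ} {a : F.ideal n} :
    F.reesMonomial n a ∈ fiberIdealModulo J F P ↔ (a : A) ∈ P ⊔ J * F.ideal n := by
  rw [mem_fiberIdealModulo]
  refine ⟨fun h => by simpa using h n, fun h m => ?_⟩
  rw [coe_reesMonomial, Polynomial.coeff_monomial]
  split_ifs with e
  · exact e ▸ h
  · exact Ideal.zero_mem _

/-- If an ideal `𝔞` of the Rees algebra contains `I t`, then `𝔞ᵏ` contains `Iᵏ Iₙ tᵏ⁺ⁿ`. -/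
theorem reesMonomial_mem_pow {F : IdealFiltration A} {I : Ideal A} (hI : I ≤ F.ideal 1)
    {𝔞 : Ideal F.rees} (h : ∀ a (ha : a ∈ I), F.reesMonomial 1 ⟨a, hI ha⟩ ∈ 𝔞) (k n : ℕ)
    {b : A} (hb : b ∈ I ^ k * F.ideal n) :
    ∃ hb' : b ∈ F.ideal (n + k), F.reesMonomial (n + k) ⟨b, hb'⟩ ∈ 𝔞 ^ k := by
  induction k generalizing b with
  | zero => exact ⟨by simpa using hb, by simp⟩
  | succ k ih =>
    rw [pow_succ', mul_assoc] at hb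
    induction hb using Submodule.mul_induction_on' with
    | mem_mul_mem a ha c hc =>
      obtain ⟨hc', hc''⟩ := ih hc
      have e : 1 + (n + k) = n + (k + 1) := by ring
      have := Ideal.mul_mem_mul (h a ha) hc''
      rw [reesMonomial_mul, ← pow_succ'] at this
      exact e ▸ ⟨_, this⟩
    | add x _ y _ hx hy =>
      obtain ⟨hx, hx'⟩ := hx
      obtain ⟨hy, hy'⟩ := hy
      refine ⟨Ideal.add_mem _ hx hy, ?_⟩
      have := Ideal.add_mem _ hx' hy'
      rwa [← map_add] at this

/-- If `p` is minimal over `I`, then every element of `p` becomes nilpotent modulo `I` after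
multiplication by some element outside `p`. -/
theorem exists_mul_pow_mem_of_mem_minimalPrimes {R : Type*} [CommRing R] {I p : Ideal R}
    (hp : p ∈ I.minimalPrimes) {x : R} (hx : x ∈ p) : ∃ y ∉ p, ∃ k : ℕ, y * x ^ k ∈ I := by
  have := hp.isPrime
  by_contra! hcon
  have hdisj : Disjoint (I : Set R) (p.primeCompl ⊔ Submonoid.powers x : Submonoid R) := by
    rw [Set.disjoint_left]
    rintro z hz hz'
    obtain ⟨y, hy, w, ⟨k, rfl⟩, rfl⟩ := Submonoid.mem_sup.mp hz'
    exact hcon y hy k hz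
  obtain ⟨q, hq, hIq, hqS⟩ := Ideal.exists_le_prime_disjoint I _ hdisj
  have hqp : q ≤ p := fun z hz => by
    by_contra hzp
    exact Set.disjoint_left.mp hqS hz (Submonoid.mem_sup_left (show z ∈ p.primeCompl from hzp))
  have hpq := hp.2 ⟨hq, hIq⟩ hqp
  exact Set.disjoint_left.mp hqS (hpq hx)
    (Submonoid.mem_sup_right (Submonoid.mem_powers x))

variable [IsLocalRing A]

theorem reesMaximalIdeal_isMaximal (F : IdealFiltration A) : F.reesMaximalIdeal.IsMaximal := by
  refine RingHom.ker_isMaximal_of_surjective _ fun y => ?_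
  obtain ⟨a, rfl⟩ := residue_surjective y
  exact ⟨algebraMap A F.rees a, by simp [reesResidue]⟩

theorem reesMonomial_mem_reesMaximalIdeal (F : IdealFiltration A) {n : ℕ} (hn : 0 < n)
    (a : F.ideal n) : F.reesMonomial n a ∈ F.reesMaximalIdeal := by
  simp [mem_reesMaximalIdeal, Polynomial.coeff_monomial, hn.ne']

/-- An element of `R(F)` killed by a power of `x t` modulo `⨁ₙ (P ∩ Iₙ + J Iₙ) tⁿ` is nilpotent
modulo this ideal. For a component of positive degree, some power of it has so large a degree that
`x` acts injectively there. The component of degree zero is not a unit, as otherwise `F / P` would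
be nilpotent; hence it has a power in `J`. -/
theorem IsWeakFCModulo.mem_radical [IsNoetherianRing A] {J : Ideal A}
    (hJ : J.radical = maximalIdeal A) {F : IdealFiltration A} (hF : F.IsGood) {P : Ideal A} {x : A}
    (h : IsWeakFCModulo J F P x) {k : ℕ} {s : F.rees}
    (hs : F.reesMonomial 1 ⟨x, h.mem⟩ ^ k * s ∈ fiberIdealModulo J F P) :
    s ∈ (fiberIdealModulo J F P).radical := by
  have hJm : J ≤ maximalIdeal A := hJ ▸ Ideal.le_radical
  obtain ⟨N, hN⟩ := h.exists_mem_of_pow_mul_mem hF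
  have hcoeff : ∀ n, x ^ k * (s : Polynomial A).coeff n ∈ P ⊔ J * F.ideal (n + k) := by
    intro n
    have := hs (n + k)
    rwa [MulMemClass.coe_mul, SubmonoidClass.coe_pow, coe_reesMonomial, Polynomial.monomial_pow,
      one_mul, Polynomial.coeff_monomial_mul] at this
  have hmul : ∀ n m, ∀ y ∈ F.ideal n, ∀ z ∈ F.ideal m, x ^ k * y ∈ P ⊔ J * F.ideal (n + k) →
      x ^ k * (y * z) ∈ P ⊔ J * F.ideal (n + m + k) := by
    intro n m y _ z hz hxy
    obtain ⟨a, ha, b, hb, hab⟩ := Submodule.mem_sup.mp hxy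
    rw [← mul_assoc, ← hab, add_mul]
    refine Submodule.add_mem_sup (P.mul_mem_right _ ha) ?_
    have h1 := Ideal.mul_mem_mul hb hz
    rw [mul_assoc] at h1
    have h2 := Ideal.mul_mono_right (I := J) (F.ideal_mul_le (n + k) m) h1
    rwa [add_right_comm] at h2
  refine F.mem_of_forall_reesMonomial_mem s fun n => ?_
  set a := (s : Polynomial A).coeff n with ha
  have han : a ∈ F.ideal n := s.2 n
  rcases Nat.eq_zero_or_pos n with rfl | hn
  · have ham : a ∈ maximalIdeal A := by
      by_contra hunit
      have hu : IsUnit a := by simpa using hunit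
      refine h.not_le N (ideal_le_of_le_sup_mul hJm fun y hy => hN N le_rfl k y hy ?_)
      obtain ⟨b, hb⟩ := hu.exists_left_inv
      have := hmul 0 N a han (b * y) (Ideal.mul_mem_left _ b hy) (hcoeff 0)
      rwa [zero_add, ← mul_assoc a, mul_comm a, hb, one_mul] at this
    obtain ⟨j, hj⟩ := hJ.ge ham
    refine ⟨j, ?_⟩
    rw [reesMonomial_pow, reesMonomial_mem_fiberIdealModulo]
    change a ^ j ∈ _
    rw [zero_mul, F.ideal_zero, Ideal.mul_top]
    exact Ideal.mem_sup_right hj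
  · refine ⟨N + 1, ?_⟩
    rw [reesMonomial_pow, reesMonomial_mem_fiberIdealModulo]
    refine hN _ (by nlinarith) k _ (F.pow_mem_ideal han _) ?_
    have := hmul n (n * N) a han _ (F.pow_mem_ideal han N) (hcoeff n)
    rwa [← pow_succ', show n + n * N = n * (N + 1) by ring] at this

/-- A prime containing `⨁ₙ ((P + (x)) ∩ Iₙ + J Iₙ) tⁿ` is not minimal over
`⨁ₙ (P ∩ Iₙ + J Iₙ) tⁿ`. -/
theorem IsWeakFCModulo.exists_prime_lt [IsNoetherianRing A] {J : Ideal A}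
    (hJ : J.radical = maximalIdeal A) {F : IdealFiltration A} (hF : F.IsGood) {P : Ideal A} {x : A}
    (h : IsWeakFCModulo J F P x) (p : PrimeSpectrum F.rees)
    (hp : fiberIdealModulo J F (P ⊔ Ideal.span {x}) ≤ p.asIdeal) :
    ∃ q : PrimeSpectrum F.rees, fiberIdealModulo J F P ≤ q.asIdeal ∧ q < p := by
  obtain ⟨q, hq, hqp⟩ := Ideal.exists_minimalPrimes_le
    ((fiberIdealModulo_mono J F (le_sup_left : P ≤ P ⊔ Ideal.span {x})).trans hp)
  refine ⟨⟨q, hq.isPrime⟩, hq.le, lt_of_le_of_ne hqp fun hne => ?_⟩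
  obtain rfl : q = p.asIdeal := congrArg PrimeSpectrum.asIdeal hne
  have hx : F.reesMonomial 1 ⟨x, h.mem⟩ ∈ p.asIdeal :=
    hp (reesMonomial_mem_fiberIdealModulo.mpr
      (Ideal.mem_sup_left (Ideal.mem_sup_right (Ideal.mem_span_singleton_self x))))
  obtain ⟨y, hy, n, hn⟩ := Ideal.iUnion_minimalPrimes.subset (Set.mem_biUnion hq hx)
  rw [mul_pow] at hn
  exact hy (Ideal.radical_idem (fiberIdealModulo J F P) ▸ ⟨n, h.mem_radical hJ hF hn⟩)

theorem fiberIdealModulo_le_reesMaximalIdeal {J : Ideal A} (hJ : J ≤ maximalIdeal A)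
    (F : IdealFiltration A) {P : Ideal A} (hP : P ≤ maximalIdeal A) :
    fiberIdealModulo J F P ≤ F.reesMaximalIdeal := by
  intro f hf
  rw [mem_reesMaximalIdeal]
  exact sup_le hP (Ideal.mul_le_left.trans hJ) (hf 0)

/-- The closed point of the spectrum of the Rees algebra given by the maximal homogeneous ideal. -/
noncomputable def reesClosedPoint (F : IdealFiltration A) : PrimeSpectrum F.rees :=
  ⟨F.reesMaximalIdeal, F.reesMaximalIdeal_isMaximal.isPrime⟩

/-- Chains of primes in the fiber cone of `F / Qᵢ` that end at the maximal homogeneous ideal can be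
prolonged by `i` steps in the fiber cone of `F`. -/
theorem IsWeakFCSequence.exists_ltSeries [IsNoetherianRing A] {J : Ideal A}
    (hJ : J.radical = maximalIdeal A) {F : IdealFiltration A} (hF : F.IsGood) {s : ℕ}
    {x : Fin s → A} (h : IsWeakFCSequence J F x) (i : ℕ) (hi : i ≤ s)
    (c : LTSeries (PrimeSpectrum F.rees))
    (hc : fiberIdealModulo J F (initialIdeal x i) ≤ c.head.asIdeal)
    (hlast : c.last = F.reesClosedPoint) :
    ∃ c' : LTSeries (PrimeSpectrum F.rees), c'.length = c.length + i ∧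
      fiberIdeal J F ≤ c'.head.asIdeal ∧ c'.last = F.reesClosedPoint := by
  induction i generalizing c with
  | zero => exact ⟨c, rfl, by rwa [initialIdeal_zero, fiberIdealModulo_bot] at hc, hlast⟩
  | succ i ih =>
    rw [show i + 1 = ((⟨i, hi⟩ : Fin s) : ℕ) + 1 from rfl, initialIdeal_succ] at hc
    obtain ⟨q, hq, hqc⟩ := (h.modulo ⟨i, hi⟩).exists_prime_lt hJ hF _ hc
    obtain ⟨c', h1, h2, h3⟩ := ih (by omega) (c.cons q hqc) (by simpa using hq)
      (by simpa using hlast)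
    exact ⟨c', by rw [h1, RelSeries.cons_length]; ring, h2, h3⟩

/-- If the fiber cone of `F / P` is zero-dimensional at its maximal homogeneous ideal, then `F / P`
is nilpotent. -/
theorem exists_ideal_le_of_mem_minimalPrimes [IsNoetherianRing A] {J : Ideal A}
    (hJ : J ≤ maximalIdeal A) {F : IdealFiltration A} (hF : F.IsGood) {P : Ideal A}
    (h : F.reesMaximalIdeal ∈ (fiberIdealModulo J F P).minimalPrimes) :
    ∃ N, ∀ n ≥ N, F.ideal n ≤ P := by
  obtain ⟨-, I, hI⟩ := hF
  obtain ⟨N, hN⟩ := hI.exists_ideal_add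
  -- The ideal `𝔞` of the Rees algebra generated by `I t`.
  set φ := (F.reesMonomial 1).comp (Submodule.inclusion hI.le_ideal_one)
  obtain ⟨S, hS⟩ := (IsNoetherian.noetherian (⊤ : Submodule A I) : (⊤ : Submodule A I).FG)
  set 𝔞 : Ideal F.rees := Ideal.span (φ '' S) with h𝔞
  have hmem : ∀ a (ha : a ∈ I), F.reesMonomial 1 ⟨a, hI.le_ideal_one ha⟩ ∈ 𝔞 := by
    intro a ha
    have h1 : (⊤ : Submodule A I).map φ ≤ 𝔞.restrictScalars A := by
      rw [← hS, Submodule.map_span, Submodule.span_le]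
      exact Ideal.subset_span
    exact h1 ⟨⟨a, ha⟩, trivial, rfl⟩
  have hrad : 𝔞 ≤ (fiberIdealModulo J F P).radical := by
    rw [h𝔞, Ideal.span_le]
    rintro _ ⟨a, -, rfl⟩
    obtain ⟨y, hy, k, hk⟩ := exists_mul_pow_mem_of_mem_minimalPrimes h
      (F.reesMonomial_mem_reesMaximalIdeal one_pos ⟨a, hI.le_ideal_one a.2⟩)
    refine ⟨k, ?_⟩
    change F.reesMonomial 1 ⟨a, hI.le_ideal_one a.2⟩ ^ k ∈ _
    rw [reesMonomial_pow, reesMonomial_mem_fiberIdealModulo]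
    change (a : A) ^ k ∈ _
    rw [one_mul]
    have h1 := hk k
    rw [MulMemClass.coe_mul, SubmonoidClass.coe_pow, coe_reesMonomial, Polynomial.monomial_pow,
      one_mul] at h1
    have h2 := Polynomial.coeff_mul_monomial (y : Polynomial A) k 0 ((a : A) ^ k)
    rw [zero_add] at h2
    rw [h2] at h1
    have hu : IsUnit ((y : Polynomial A).coeff 0) := by
      rw [mem_reesMaximalIdeal] at hy
      simpa using hy
    exact (Ideal.unit_mul_mem_iff_mem _ hu).mp h1
  obtain ⟨k, hk⟩ := Ideal.exists_pow_le_of_le_radical_of_fg hrad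
    ⟨(S.finite_toSet.image φ).toFinset, by simp [h𝔞]⟩
  refine ⟨N + k, fun n hn => (F.antitone_ideal hn).trans (ideal_le_of_le_sup_mul hJ ?_)⟩
  intro b hb
  rw [hN] at hb
  obtain ⟨_, hb'⟩ := reesMonomial_mem_pow hI.le_ideal_one hmem k N hb
  exact reesMonomial_mem_fiberIdealModulo.mp (hk hb')

end IdealFiltration

/-! ### Dimension of the fiber cone and the reduction -/

namespace IdealFiltration

variable {A : Type*} [CommRing A]

theorem mul_mem_fiberIdeal {J J' : Ideal A} {F : IdealFiltration A} {f g : F.rees}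
    (hf : f ∈ fiberIdeal J F) (hg : g ∈ fiberIdeal J' F) : f * g ∈ fiberIdeal (J * J') F := by
  intro n
  rw [MulMemClass.coe_mul, Polynomial.coeff_mul]
  refine Ideal.sum_mem _ fun p hp => ?_
  have h := Ideal.mul_mem_mul (hf p.1) (hg p.2)
  rw [mul_mul_mul_comm] at h
  have h' := Ideal.mul_mono_right (I := J * J') (F.ideal_mul_le p.1 p.2) h
  rwa [Finset.HasAntidiagonal.mem_antidiagonal.mp hp] at h'

theorem pow_mem_fiberIdeal {J : Ideal A} {F : IdealFiltration A} {f : F.rees}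
    (hf : f ∈ fiberIdeal J F) (k : ℕ) : f ^ k ∈ fiberIdeal (J ^ k) F := by
  induction k with
  | zero =>
    intro n
    rw [pow_zero, pow_zero, Ideal.one_eq_top, Ideal.top_mul]
    exact (1 : F.rees).2 n
  | succ k ih =>
    rw [pow_succ, pow_succ]
    exact mul_mem_fiberIdeal ih hf

theorem fiberIdeal_mono {J J' : Ideal A} (h : J ≤ J') (F : IdealFiltration A) :
    fiberIdeal J F ≤ fiberIdeal J' F :=
  fun _ hf n => Ideal.mul_mono_left h (hf n)

/-- The spectrum of the fiber cone as a closed subset of the spectrum of the Rees algebra. -/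
noncomputable def fiberConeSpectrumOrderIso (J : Ideal A) (F : IdealFiltration A) :
    PrimeSpectrum (FiberCone J F) ≃o PrimeSpectrum.zeroLocus (fiberIdeal J F : Set F.rees) :=
  Ideal.primeSpectrumOrderIsoZeroLocusOfSurj _ (toFiberCone_surjective J F) (ker_toFiberCone J F)

theorem ringKrullDim_fiberCone_eq (F : IdealFiltration A) (J : Ideal A) :
    ringKrullDim (FiberCone J F) =
      Order.krullDim (PrimeSpectrum.zeroLocus (fiberIdeal J F : Set F.rees)) :=
  Order.krullDim_eq_of_orderIso (fiberConeSpectrumOrderIso J F)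

variable [IsLocalRing A]

/-- The fiber cones with respect to `J` and `𝔪` have the same dimension, as `𝔪 R(F)` and `J R(F)`
have the same radical. -/
theorem ringKrullDim_fiberCone [IsNoetherianRing A] {J : Ideal A}
    (hJ : J.radical = maximalIdeal A) (F : IdealFiltration A) :
    ringKrullDim (FiberCone J F) = F.analyticSpread := by
  have key : PrimeSpectrum.zeroLocus (fiberIdeal J F : Set F.rees) =
      PrimeSpectrum.zeroLocus (fiberIdeal (maximalIdeal A) F : Set F.rees) := by
    refine le_antisymm ?_ (PrimeSpectrum.zeroLocus_anti_mono
      (fiberIdeal_mono (hJ ▸ Ideal.le_radical) F))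
    intro p hp f hf
    obtain ⟨k, hk⟩ := Ideal.exists_pow_le_of_le_radical_of_fg hJ.ge
      (IsNoetherian.noetherian (maximalIdeal A))
    exact p.isPrime.mem_of_pow_mem k (hp (fiberIdeal_mono hk F (pow_mem_fiberIdeal hf k)))
  rw [analyticSpread, F.ringKrullDim_fiberCone_eq, F.ringKrullDim_fiberCone_eq, key]

/-- A chain of primes of the Rees algebra containing `⨁ₙ J Iₙ tⁿ` and ending at the maximal
homogeneous ideal bounds the dimension of the localized fiber cone from below. -/
theorem length_le_ringKrullDim_localFiberCone {J : Ideal A} (hJ : J.radical = maximalIdeal A)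
    {F : IdealFiltration A} (c : LTSeries (PrimeSpectrum F.rees))
    (hc : fiberIdeal J F ≤ c.head.asIdeal) (hlast : c.last = F.reesClosedPoint) :
    (c.length : WithBot ℕ∞) ≤ ringKrullDim (LocalFiberCone hJ F) := by
  have hprime := fiberMaximalIdeal_isPrime hJ F
  let e := fiberConeSpectrumOrderIso J F
  have hmem : ∀ i, c i ∈ PrimeSpectrum.zeroLocus (fiberIdeal J F : Set F.rees) := fun i =>
    hc.trans (c.head_le i)
  let d : LTSeries (PrimeSpectrum (FiberCone J F)) :=
    { length := c.length
      toFun := fun i => e.symm ⟨c i, hmem i⟩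
      step := fun i => e.symm.strictMono (c.step i) }
  have hd : d.last = ⟨fiberMaximalIdeal J F, hprime⟩ := by
    change e.symm ⟨c.last, hmem _⟩ = _
    refine e.symm_apply_eq.mpr ?_
    refine Subtype.ext (hlast.trans (PrimeSpectrum.ext ?_))
    change F.reesMaximalIdeal = (F.reesMaximalIdeal.map (toFiberCone J F)).comap (toFiberCone J F)
    rw [Ideal.comap_map_of_surjective _ (toFiberCone_surjective J F), ← RingHom.ker_eq_comap_bot,
      ker_toFiberCone, eq_comm, sup_eq_left, ← fiberIdealModulo_bot]
    exact fiberIdealModulo_le_reesMaximalIdeal (hJ ▸ Ideal.le_radical) F bot_le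
  rw [IsLocalization.AtPrime.ringKrullDim_eq_height (fiberMaximalIdeal J F)]
  have h1 := Order.length_le_height_last (p := d)
  rw [hd, ← PrimeSpectrum.height_eq_orderHeight] at h1
  exact_mod_cast h1

theorem ringKrullDim_localFiberCone_le [IsNoetherianRing A] {J : Ideal A}
    (hJ : J.radical = maximalIdeal A) (F : IdealFiltration A) :
    ringKrullDim (LocalFiberCone hJ F) ≤ F.analyticSpread := by
  have := fiberMaximalIdeal_isPrime hJ F
  rw [← ringKrullDim_fiberCone hJ,
    IsLocalization.AtPrime.ringKrullDim_eq_height (fiberMaximalIdeal J F)]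
  exact Ideal.height_le_ringKrullDim_of_ne_top (Ideal.IsPrime.ne_top this)

theorem IsGood.ideal_one_le {F : IdealFiltration A} (hF : F.IsGood) :
    F.ideal 1 ≤ maximalIdeal A :=
  le_maximalIdeal hF.1

/-- For a weak-(FC)-sequence as long as the analytic spread `l`, each member lowers the height of
the maximal homogeneous ideal of the fiber cone by at least one; as the total drop is at most `l`,
this height is `l`, and nothing of positive dimension is left modulo the whole sequence. -/
theorem IsWeakFCSequence.ringKrullDim_localFiberCone [IsNoetherianRing A] {J : Ideal A}
    (hJ : J.radical = maximalIdeal A) {F : IdealFiltration A} (hF : F.IsGood) {l : ℕ}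
    (hl : F.analyticSpread = (l : WithBot ℕ∞)) {x : Fin l → A} (hx : IsWeakFCSequence J F x) :
    ringKrullDim (LocalFiberCone hJ F) = (l : WithBot ℕ∞) ∧
      ∃ N, ∀ n ≥ N, F.ideal n ≤ initialIdeal x l := by
  have hJm : J ≤ maximalIdeal A := hJ ▸ Ideal.le_radical
  have hK : fiberIdealModulo J F (initialIdeal x l) ≤ F.reesMaximalIdeal :=
    fiberIdealModulo_le_reesMaximalIdeal hJm F ((initialIdeal_le x hx.1 l).trans hF.ideal_one_le)
  let c₀ : LTSeries (PrimeSpectrum F.rees) := RelSeries.singleton _ F.reesClosedPoint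
  have hle := hl ▸ ringKrullDim_localFiberCone_le hJ F
  constructor
  · obtain ⟨c, h1, h2, h3⟩ := hx.exists_ltSeries hJ hF l le_rfl
      c₀ hK rfl
    refine le_antisymm hle ?_
    have := length_le_ringKrullDim_localFiberCone hJ c h2 h3
    simpa [h1, c₀] using this
  · refine exists_ideal_le_of_mem_minimalPrimes hJm hF
      ⟨⟨F.reesMaximalIdeal_isMaximal.isPrime, hK⟩, fun q hq hqM => ?_⟩
    by_contra hne
    have hlt : (⟨q, hq.1⟩ : PrimeSpectrum F.rees) < F.reesClosedPoint :=
      lt_of_le_not_ge hqM hne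
    obtain ⟨c, h1, h2, h3⟩ := hx.exists_ltSeries hJ hF l le_rfl
      (c₀.cons ⟨q, hq.1⟩ hlt) ((RelSeries.head_cons c₀ _ hlt).symm ▸ hq.2)
      (RelSeries.last_cons c₀ _ hlt)
    have := (length_le_ringKrullDim_localFiberCone hJ c h2 h3).trans hle
    have h4 : c.length = 0 + 1 + l := h1.trans (congrArg (· + l) (RelSeries.cons_length c₀ _ hlt))
    rw [h4] at this
    norm_cast at this
    omega

/-- A weak-(FC)-sequence as long as the analytic spread generates a reduction. -/
theorem IsWeakFCSequence.isReduction [IsNoetherianRing A] {J : Ideal A}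
    (hJ : J.radical = maximalIdeal A) {F : IdealFiltration A} (hF : F.IsGood) {l : ℕ}
    (hl : F.analyticSpread = (l : WithBot ℕ∞)) {x : Fin l → A} (hx : IsWeakFCSequence J F x) :
    IsReduction (Ideal.span (Set.range x)) F := by
  rw [← initialIdeal_self]
  have hle : ∀ n, initialIdeal x l * F.ideal n ≤ F.ideal (n + 1) := fun n => by
    rw [add_comm]
    exact (Ideal.mul_mono_left (initialIdeal_le x hx.1 l)).trans (F.ideal_mul_le 1 n)
  obtain ⟨N₁, h₁⟩ := (hx.ringKrullDim_localFiberCone hJ hF hl).2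
  obtain ⟨N₂, h₂⟩ := hx.initialIdeal_inf_le l le_rfl
  refine ⟨hle, max N₁ N₂, fun n hn => le_antisymm ?_ (hle n)⟩
  exact (le_inf (h₁ (n + 1) (by omega)) le_rfl).trans (h₂ n (by omega))

end IdealFiltration

/-! ### Hilbert functions of the fiber cones of quotients -/

/-- If `f` induces an injection `M / p → M' / p'` whose cokernel is `M' / q`, then lengths add. -/
theorem Module.length_quotient_eq_add {R M M' : Type*} [Ring R] [AddCommGroup M] [Module R M]
    [AddCommGroup M'] [Module R M'] (f : M →ₗ[R] M') {p : Submodule R M} {p' q : Submodule R M'}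
    (hp : p'.comap f = p) (hq : q = p' ⊔ LinearMap.range f) :
    Module.length R (M' ⧸ p') = Module.length R (M ⧸ p) + Module.length R (M' ⧸ q) := by
  have hpq : p' ≤ q := hq ▸ le_sup_left
  refine Module.length_eq_add_of_exact (p.mapQ p' f hp.ge) (Submodule.factor hpq) ?_
    (Submodule.factor_surjective hpq) ?_
  · rw [← LinearMap.ker_eq_bot, Submodule.ker_mapQ, hp, Submodule.mkQ_map_self]
  · rw [LinearMap.exact_iff, Submodule.range_mapQ]
    ext y
    obtain ⟨y, rfl⟩ := Submodule.mkQ_surjective _ y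
    have h1 : Submodule.factor hpq (p'.mkQ y) = q.mkQ y := Submodule.factor_mk hpq y
    rw [LinearMap.mem_ker, h1, ← LinearMap.mem_ker, Submodule.ker_mkQ, hq,
      ← Submodule.mem_comap, Submodule.comap_map_mkQ]

namespace IdealFiltration

variable {A : Type*} [CommRing A]

/-- The length of the degree `n` part `Iₙ / (P ∩ Iₙ + J Iₙ)` of the fiber cone of `F / P`. -/
noncomputable def fiberLength (J : Ideal A) (F : IdealFiltration A) (P : Ideal A) (n : ℕ) : ℕ∞ :=
  Module.length A (F.ideal n ⧸ (P ⊔ J * F.ideal n).submoduleOf (F.ideal n))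

theorem mem_submoduleOf {P I : Ideal A} {a : I} : a ∈ P.submoduleOf I ↔ (a : A) ∈ P :=
  Iff.rfl

theorem fiberLength_congr {J : Ideal A} {F : IdealFiltration A} {P P' : Ideal A} {n : ℕ}
    (h : P ⊓ F.ideal n = P' ⊓ F.ideal n) : fiberLength J F P n = fiberLength J F P' n := by
  have key : ∀ P P' : Ideal A, P ⊓ F.ideal n ≤ P' →
      (P ⊔ J * F.ideal n).submoduleOf (F.ideal n) ≤
        (P' ⊔ J * F.ideal n).submoduleOf (F.ideal n) := by
    intro P P' h z hz
    obtain ⟨p, hp, w, hw, hpw⟩ := Submodule.mem_sup.mp (mem_submoduleOf.mp hz)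
    rw [mem_submoduleOf, ← hpw]
    refine Submodule.add_mem_sup (h ⟨hp, ?_⟩) hw
    rw [← add_sub_cancel_right p w, hpw]
    exact Ideal.sub_mem _ z.2 (Ideal.mul_le_right hw)
  rw [fiberLength, fiberLength,
    le_antisymm (key P P' (h.le.trans inf_le_left)) (key P' P (h.ge.trans inf_le_left))]

theorem length_quotient_inf_sup_mul (J : Ideal A) (F : IdealFiltration A) (P : Ideal A) (n : ℕ) :
    Module.length A (F.ideal n ⧸ ((P ⊓ F.ideal n) ⊔ J * F.ideal n).submoduleOf (F.ideal n)) =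
      fiberLength J F P n :=
  fiberLength_congr (by rw [inf_assoc, inf_idem])

theorem fiberLength_eq_zero {J : Ideal A} {F : IdealFiltration A} {P : Ideal A} {n : ℕ}
    (h : F.ideal n ≤ P) : fiberLength J F P n = 0 := by
  rw [fiberLength, Module.length_eq_zero_iff, Submodule.Quotient.subsingleton_iff, eq_top_iff]
  exact fun z _ => Ideal.mem_sup_left (h z.2)

theorem fiberLength_ne_top [IsLocalRing A] [IsNoetherianRing A] {J : Ideal A}
    (hJ : J.radical = maximalIdeal A) (F : IdealFiltration A) (P : Ideal A) (n : ℕ) :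
    fiberLength J F P n ≠ ⊤ := by
  have : IsArtinianRing (A ⧸ J) := by
    rw [isArtinianRing_iff_isNoetherianRing_krullDimLE_zero]
    refine ⟨inferInstance, Ring.KrullDimLE.mk₀ fun p hp => ?_⟩
    have h1 : (p.comap (Ideal.Quotient.mk J)) = maximalIdeal A := by
      refine le_antisymm (le_maximalIdeal (Ideal.IsPrime.comap _).ne_top) ?_
      rw [← hJ, (Ideal.IsPrime.comap _).radical_le_iff]
      intro a ha
      rw [Ideal.mem_comap, Ideal.Quotient.eq_zero_iff_mem.mpr ha]
      exact p.zero_mem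
    have h2 : (p.comap (Ideal.Quotient.mk J)).IsMaximal := h1 ▸ inferInstance
    have h3 := Ideal.map_comap_of_surjective _ Ideal.Quotient.mk_surjective p
    have h4 := (Ideal.map_eq_top_or_isMaximal_of_surjective _ Ideal.Quotient.mk_surjective
      h2).resolve_left (by rw [h3]; exact hp.ne_top)
    rwa [h3] at h4
  set M := F.ideal n ⧸ (P ⊔ J * F.ideal n).submoduleOf (F.ideal n)
  have htor : Module.IsTorsionBySet A M J := by
    rintro z ⟨a, ha⟩
    obtain ⟨z, rfl⟩ := Submodule.mkQ_surjective _ z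
    rw [← map_smul, Submodule.mkQ_apply, Submodule.Quotient.mk_eq_zero]
    exact Ideal.mem_sup_right (Ideal.mul_mem_mul ha z.2)
  let _ := htor.module
  have : Module.Finite (A ⧸ J) M := Module.Finite.of_restrictScalars_finite A _ _
  rw [fiberLength, Module.length_eq_of_surjective (R := A ⧸ J) Ideal.Quotient.mk_surjective]
  exact Module.length_ne_top

/-- Multiplication by `x ∈ I₁`, as a map from `Iₙ` to `Iₙ₊₁`. -/
noncomputable def mulMap (F : IdealFiltration A) {x : A} (hx : x ∈ F.ideal 1) (n : ℕ) :
    F.ideal n →ₗ[A] F.ideal (n + 1) :=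
  (LinearMap.mulLeft A x).restrict fun y hy => by
    rw [add_comm]
    exact F.ideal_mul_le 1 n (Ideal.mul_mem_mul hx hy)

@[simp]
theorem coe_mulMap (F : IdealFiltration A) {x : A} (hx : x ∈ F.ideal 1) (n : ℕ) (y : F.ideal n) :
    (F.mulMap hx n y : A) = x * y :=
  rfl

theorem mul_mem_sup_mul {J : Ideal A} {F : IdealFiltration A} {P : Ideal A} {x : A}
    (hx : x ∈ F.ideal 1) {n : ℕ} {y : A} (hy : y ∈ P ⊔ J * F.ideal n) :
    x * y ∈ P ⊔ J * F.ideal (n + 1) := by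
  obtain ⟨p, hp, w, hw, rfl⟩ := Submodule.mem_sup.mp hy
  rw [mul_add]
  refine Submodule.add_mem_sup (P.mul_mem_left _ hp) ?_
  have h1 := Ideal.mul_mem_mul hx hw
  rw [mul_left_comm] at h1
  rw [add_comm n 1]
  exact Ideal.mul_mono_right (F.ideal_mul_le 1 n) h1

/-- In large degrees the Hilbert function of the fiber cone of `F / (P + (x))` is the difference
function of that of `F / P`. -/
theorem IsWeakFCModulo.exists_fiberLength_succ [IsNoetherianRing A] {J : Ideal A}
    {F : IdealFiltration A} (hF : F.IsGood) {P : Ideal A} {x : A} (h : IsWeakFCModulo J F P x) :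
    ∃ N, ∀ n ≥ N, fiberLength J F P (n + 1) =
      fiberLength J F P n + fiberLength J F (P ⊔ Ideal.span {x}) (n + 1) := by
  obtain ⟨N₁, h₁⟩ := h.exists_mem_of_mul_mem hF
  obtain ⟨N₂, h₂⟩ := h.sup_inf_le
  refine ⟨max N₁ N₂, fun n hn => Module.length_quotient_eq_add (F.mulMap h.mem n) ?_ ?_⟩
  · ext y
    exact ⟨h₁ n (le_of_max_le_left hn) y y.2, mul_mem_sup_mul h.mem⟩
  · refine le_antisymm (fun z hz => ?_) (sup_le (fun z hz => ?_) ?_)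
    · obtain ⟨u, hu, w, hw, huw⟩ := Submodule.mem_sup.mp (mem_submoduleOf.mp hz)
      have hu' : u ∈ F.ideal (n + 1) := by
        rw [← add_sub_cancel_right u w, huw]
        exact Ideal.sub_mem _ z.2 (Ideal.mul_le_right hw)
      obtain ⟨p, hp, v, hv, hpv⟩ := Submodule.mem_sup.mp (h₂ n (le_of_max_le_right hn) ⟨hu, hu'⟩)
      obtain ⟨v', hv', rfl⟩ := Ideal.mem_span_singleton_mul.mp hv
      have hz' : z = (z - F.mulMap h.mem n ⟨v', hv'⟩) + F.mulMap h.mem n ⟨v', hv'⟩ := by abel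
      rw [hz']
      refine Submodule.add_mem_sup ?_ ⟨_, rfl⟩
      rw [mem_submoduleOf]
      have : ((z - F.mulMap h.mem n ⟨v', hv'⟩ : F.ideal (n + 1)) : A) = p + w := by
        rw [Submodule.coe_sub, coe_mulMap, ← huw, ← hpv]
        ring
      rw [this]
      exact Submodule.add_mem_sup hp hw
    · exact (sup_le_sup_right (le_sup_left : P ≤ P ⊔ Ideal.span {x}) (J * F.ideal (n + 1))) hz
    · rintro _ ⟨y, rfl⟩
      exact Ideal.mem_sup_left (Ideal.mem_sup_right
        (Ideal.mul_mem_right _ _ (Ideal.mem_span_singleton_self x)))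

/-- `x` is a nonzerodivisor modulo the saturation `P : I₁^∞`. -/
theorem IsWeakFCModulo.mem_saturation_of_mul_mem [IsNoetherianRing A] {J : Ideal A}
    {F : IdealFiltration A} {P : Ideal A} {x : A} (h : IsWeakFCModulo J F P x) {y : A}
    (hy : x * y ∈ idealSaturation P (F.ideal 1)) : y ∈ idealSaturation P (F.ideal 1) := by
  obtain ⟨k, hk⟩ := hy
  obtain ⟨m, hm⟩ := exists_idealSaturation_mul_pow_le P (F.ideal 1)
  refine ⟨k + m, fun b hb => ?_⟩
  rw [pow_add] at hb
  induction hb using Submodule.mul_induction_on' with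
  | mem_mul_mem b hb c hc =>
    rw [← mul_assoc]
    exact hm (Ideal.mul_mem_mul (h.mem_saturation _ (by rw [← mul_assoc]; exact hk b hb)) hc)
  | add b _ c _ hb hc =>
    rw [mul_add]
    exact P.add_mem hb hc

/-- Where `Iₙ₊₁ = (P + (x)) Iₙ`, multiplication by `x` identifies the parts of degree `n` and
`n + 1` of the fiber cone of `F / (P : I₁^∞)`. -/
theorem IsWeakFCModulo.fiberLength_saturation_succ [IsNoetherianRing A] {J : Ideal A}
    {F : IdealFiltration A} {P : Ideal A} {x : A} (h : IsWeakFCModulo J F P x) {n : ℕ}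
    (hn : (P ⊔ Ideal.span {x}) * F.ideal n = F.ideal (n + 1)) :
    fiberLength J F (idealSaturation P (F.ideal 1)) (n + 1) =
      fiberLength J F (idealSaturation P (F.ideal 1)) n := by
  set B := idealSaturation P (F.ideal 1)
  have hPB : P ≤ B := le_idealSaturation P _
  have hle : ∀ K : Ideal A, (P ⊔ Ideal.span {x}) * K ≤ B ⊔ Ideal.span {x} * K := fun K => by
    rw [Ideal.sup_mul]
    exact sup_le_sup_right (Ideal.mul_le_left.trans hPB) _
  have h0 := fiberLength_eq_zero (J := J) (F := F) (le_top : F.ideal (n + 1) ≤ ⊤)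
  rw [← add_zero (fiberLength J F B n), ← h0]
  refine Module.length_quotient_eq_add (F.mulMap h.mem n) ?_ ?_
  · ext y
    refine ⟨fun hy => ?_, mul_mem_sup_mul h.mem⟩
    have hy' : x * (y : A) ∈ B ⊔ Ideal.span {x} * (J * F.ideal n) := by
      have h1 : B ⊔ J * F.ideal (n + 1) ≤ B ⊔ Ideal.span {x} * (J * F.ideal n) := by
        rw [← hn, mul_left_comm]
        exact sup_le le_sup_left (hle _)
      exact h1 hy
    obtain ⟨b, hb, v, hv, hbv⟩ := Submodule.mem_sup.mp hy'
    obtain ⟨w, hw, rfl⟩ := Ideal.mem_span_singleton_mul.mp hv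
    rw [mem_submoduleOf, ← sub_add_cancel (y : A) w]
    refine Submodule.add_mem_sup (h.mem_saturation_of_mul_mem ?_) hw
    rwa [mul_sub, ← hbv, add_sub_cancel_right]
  · refine le_antisymm (fun z _ => ?_) fun z _ => Ideal.mem_sup_left trivial
    obtain ⟨b, hb, v, hv, hbv⟩ := Submodule.mem_sup.mp (hle _ (hn.ge z.2))
    obtain ⟨w, hw, rfl⟩ := Ideal.mem_span_singleton_mul.mp hv
    have hz' : z = (z - F.mulMap h.mem n ⟨w, hw⟩) + F.mulMap h.mem n ⟨w, hw⟩ := by abel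
    rw [hz']
    refine Submodule.add_mem_sup ?_ ⟨_, rfl⟩
    rw [mem_submoduleOf, Submodule.coe_sub, coe_mulMap, ← hbv]
    exact Ideal.mem_sup_left (by simpa using hb)

end IdealFiltration

/-! ### Lengths over the localized fiber cone -/

section LengthRestrictScalars

variable {A S N : Type*} [CommRing A] [CommRing S] [Algebra A S] [AddCommGroup N] [Module A N]
  [Module S N] [IsScalarTower A S N]

theorem Module.length_eq_of_smul_eq_zero {𝔐 : Ideal S}
    (hsurj : ∀ s : S, ∃ a : A, s - algebraMap A S a ∈ 𝔐) (hN : ∀ m ∈ 𝔐, ∀ y : N, m • y = 0) :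
    Module.length A N = Module.length S N := by
  let e : Submodule S N ≃o Submodule A N :=
    { toFun := fun p => p.restrictScalars A
      invFun := fun p =>
        { p with
          smul_mem' := fun s y hy => by
            obtain ⟨a, ha⟩ := hsurj s
            have h := hN _ ha y
            rw [sub_smul, algebraMap_smul, sub_eq_zero] at h
            rw [h]
            exact p.smul_mem a hy }
      left_inv := fun _ => rfl
      right_inv := fun _ => rfl
      map_rel_iff' := Iff.rfl }
  apply WithBot.coe_injective
  rw [Module.coe_length, Module.coe_length, Order.krullDim_eq_of_orderIso e]

/-- Let `𝔐` be an ideal of an `A`-algebra `S` such that `A → S / 𝔐` is surjective. For an `S`-module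
killed by a power of `𝔐`, length may be computed over `A`. -/
theorem Module.length_eq_of_pow_smul_eq_zero {𝔐 : Ideal S}
    (hsurj : ∀ s : S, ∃ a : A, s - algebraMap A S a ∈ 𝔐) (n : ℕ)
    (hN : ∀ m ∈ 𝔐 ^ n, ∀ y : N, m • y = 0) :
    Module.length A N = Module.length S N := by
  induction n generalizing N with
  | zero =>
    have : Subsingleton N := subsingleton_of_forall_eq 0 fun y => by
      simpa using hN 1 (by simp) y
    rw [Module.length_eq_zero, Module.length_eq_zero]
  | succ n ih =>
    let p : Submodule S N := 𝔐 ^ n • ⊤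
    have hp : Module.length A p = Module.length S p := by
      refine Module.length_eq_of_smul_eq_zero hsurj fun m hm y => Subtype.ext ?_
      have h := Submodule.smul_mem_smul hm y.2
      rw [← Submodule.mul_smul, ← pow_succ'] at h
      have h' : 𝔐 ^ (n + 1) • (⊤ : Submodule S N) ≤ ⊥ :=
        Submodule.smul_le.mpr fun r hr z _ => hN r hr z
      exact h' h
    have hq : Module.length A (N ⧸ p) = Module.length S (N ⧸ p) := by
      refine ih fun m hm y => ?_
      obtain ⟨y, rfl⟩ := p.mkQ_surjective y
      rw [← map_smul, Submodule.mkQ_apply, Submodule.Quotient.mk_eq_zero]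
      exact Submodule.smul_mem_smul hm trivial
    rw [Module.length_eq_add_of_exact p.subtype p.mkQ p.subtype_injective p.mkQ_surjective
      (LinearMap.exact_subtype_mkQ p), ← hp, ← hq]
    exact Module.length_eq_add_of_exact (p.subtype.restrictScalars A) (p.mkQ.restrictScalars A)
      p.subtype_injective p.mkQ_surjective (LinearMap.exact_subtype_mkQ p)

end LengthRestrictScalars

theorem Module.length_quotient_comap {R S : Type*} [CommRing R] [CommRing S] {f : R →+* S}
    (hf : Function.Surjective f) (I : Ideal S) :
    Module.length R (R ⧸ I.comap f) = Module.length S (S ⧸ I) := by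
  let _ : Algebra R S := f.toAlgebra
  let g : R →ₗ[R] S ⧸ I := (I.mkQ.restrictScalars R).comp (Algebra.linearMap R S)
  have hg : Function.Surjective g := I.mkQ_surjective.comp hf
  have hker : LinearMap.ker g = I.comap f := by
    ext r
    exact Submodule.Quotient.mk_eq_zero I
  rw [← Module.length_eq_of_surjective (S := R) (R := S) (M := S ⧸ I) hf,
    ← (g.quotKerEquivOfSurjective hg).length_eq, hker]

/-- The residue rings of a local ring `Rₚ` modulo powers of its maximal ideal have the same length
as those of `R` modulo powers of `p`. -/
theorem length_localization_quotient_pow {R : Type*} [CommRing R] (p : Ideal R) [p.IsMaximal]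
    (n : ℕ) :
    Module.length (Localization.AtPrime p)
        (Localization.AtPrime p ⧸ maximalIdeal (Localization.AtPrime p) ^ n) =
      Module.length R (R ⧸ p ^ n) := by
  let e := IsLocalization.AtPrime.equivQuotMaximalIdealPow p (Localization.AtPrime p) n
  set X := Localization.AtPrime p ⧸ maximalIdeal (Localization.AtPrime p) ^ n
  rw [Module.length_eq_of_surjective (S := Localization.AtPrime p) (R := X) (M := X)
    Ideal.Quotient.mk_surjective, e.toLinearEquiv.length_eq]
  refine (Module.length_eq_of_surjective (S := R) (R := X) (M := X) fun y => ?_).symm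
  obtain ⟨z, rfl⟩ := e.surjective y
  obtain ⟨z, rfl⟩ := Ideal.Quotient.mk_surjective z
  exact ⟨z, (e.commutes z).symm⟩

namespace IdealFiltration

variable {A : Type*} [CommRing A]

/-- The ideal of the elements of the Rees algebra whose components of degree less than `n` vanish in
the fiber cone with respect to `J`. -/
def fiberIdealBelow (J : Ideal A) (F : IdealFiltration A) (n : ℕ) : Ideal F.rees where
  carrier := {f | ∀ k < n, (f : Polynomial A).coeff k ∈ J * F.ideal k}
  zero_mem' := fun k _ => by simp
  add_mem' := by
    intro f g hf hg k hk
    simpa using Ideal.add_mem _ (hf k hk) (hg k hk)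
  smul_mem' := by
    intro c f hf k hk
    rw [smul_eq_mul, MulMemClass.coe_mul, Polynomial.coeff_mul]
    refine Ideal.sum_mem _ fun p hp => ?_
    have hp' := Finset.HasAntidiagonal.mem_antidiagonal.mp hp
    have h := Ideal.mul_mem_mul (c.2 p.1) (hf p.2 (by omega))
    rw [mul_left_comm] at h
    have h' := Ideal.mul_mono_right (I := J) (F.ideal_mul_le p.1 p.2) h
    rwa [hp'] at h'

theorem length_rees_quotient_fiberIdealBelow (J : Ideal A) (F : IdealFiltration A) (n : ℕ) :
    Module.length A (F.rees ⧸ fiberIdealBelow J F n) =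
      ∑ k ∈ Finset.range n, fiberLength J F ⊥ k := by
  let φ : F.rees →ₗ[A]
      (Π k : Fin n, F.ideal k ⧸ (⊥ ⊔ J * F.ideal k).submoduleOf (F.ideal k)) :=
    LinearMap.pi fun k => (Submodule.mkQ _).comp
      (((Polynomial.lcoeff A k).comp F.rees.val.toLinearMap).codRestrict (F.ideal k) fun f => f.2 k)
  have hker : LinearMap.ker φ = (fiberIdealBelow J F n).restrictScalars A := by
    ext f
    rw [LinearMap.mem_ker, funext_iff]
    have h : ∀ k : Fin n, φ f k = 0 ↔ (f : Polynomial A).coeff k ∈ J * F.ideal k := fun k => by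
      change Submodule.mkQ _ _ = 0 ↔ _
      rw [Submodule.mkQ_apply, Submodule.Quotient.mk_eq_zero, mem_submoduleOf, bot_sup_eq]
      rfl
    simp only [Pi.zero_apply, h]
    exact ⟨fun H k hk => H ⟨k, hk⟩, fun H k => H k k.2⟩
  have hsurj : Function.Surjective φ := by
    intro y
    choose z hz using fun k => Submodule.mkQ_surjective _ (y k)
    refine ⟨∑ k : Fin n, F.reesMonomial k (z k), funext fun k => ?_⟩
    rw [← hz k]
    refine congrArg (Submodule.mkQ _) (Subtype.ext ?_)
    change ((∑ k : Fin n, F.reesMonomial k (z k) : F.rees) : Polynomial A).coeff k = z k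
    rw [AddSubmonoidClass.coe_finsetSum, Polynomial.finsetSum_coeff, Finset.sum_eq_single k]
    · simp
    · intro j _ hj
      rw [coe_reesMonomial, Polynomial.coeff_monomial, if_neg (fun h => hj (Fin.ext h))]
    · simp
  have e1 := (φ.quotKerEquivOfSurjective hsurj).length_eq
  rw [hker, Module.length_pi_of_fintype] at e1
  rw [← Fin.sum_univ_eq_sum_range fun k => fiberLength J F ⊥ k]
  exact e1

variable [IsLocalRing A]

theorem exists_sub_algebraMap_mem (F : IdealFiltration A) (f : F.rees) :
    ∃ a : A, f - algebraMap A F.rees a ∈ F.reesMaximalIdeal :=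
  ⟨(f : Polynomial A).coeff 0, by simp [mem_reesMaximalIdeal]⟩

/-- Lengths of residue rings of the localized fiber cone, computed over `A` in the Rees algebra. -/
theorem length_localFiberCone_quotient_pow {J : Ideal A} (hJ : J.radical = maximalIdeal A)
    (F : IdealFiltration A) (n : ℕ) :
    Module.length (LocalFiberCone hJ F)
        (LocalFiberCone hJ F ⧸ maximalIdeal (LocalFiberCone hJ F) ^ n) =
      Module.length A (F.rees ⧸ (F.reesMaximalIdeal ^ n ⊔ fiberIdeal J F)) := by
  have := fiberMaximalIdeal_isPrime hJ F
  have hsurj := toFiberCone_surjective J F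
  have : (fiberMaximalIdeal J F).IsMaximal :=
    have := F.reesMaximalIdeal_isMaximal
    (Ideal.map_eq_top_or_isMaximal_of_surjective _ hsurj this).resolve_left
      (fiberMaximalIdeal_isPrime hJ F).ne_top
  refine (length_localization_quotient_pow (fiberMaximalIdeal J F) n).trans ?_
  rw [← Module.length_quotient_comap hsurj, fiberMaximalIdeal, ← Ideal.map_pow,
    Ideal.comap_map_of_surjective _ hsurj, ← RingHom.ker_eq_comap_bot, ker_toFiberCone]
  refine (Module.length_eq_of_pow_smul_eq_zero F.exists_sub_algebraMap_mem n fun m hm y => ?_).symm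
  obtain ⟨y, rfl⟩ := Submodule.mkQ_surjective _ y
  rw [← map_smul, Submodule.mkQ_apply, Submodule.Quotient.mk_eq_zero]
  exact Ideal.mem_sup_left (Ideal.mul_mem_right y _ hm)

/-- In the fiber cone the powers of the maximal homogeneous ideal and the ideals of elements of
order at least `n` are cofinal, with a bounded shift. -/
theorem exists_reesMaximalIdeal_pow_le [IsNoetherianRing A] {J : Ideal A}
    (hJ : J.radical = maximalIdeal A) {F : IdealFiltration A} (hF : F.IsGood) :
    (∃ s, ∀ n, F.reesMaximalIdeal ^ (n + s) ⊔ fiberIdeal J F ≤ fiberIdealBelow J F n) ∧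
      ∃ N, ∀ n, fiberIdealBelow J F (n + N) ≤ F.reesMaximalIdeal ^ n ⊔ fiberIdeal J F := by
  constructor
  · obtain ⟨s, hs⟩ := Ideal.exists_pow_le_of_le_radical_of_fg hJ.ge
      (IsNoetherian.noetherian (maximalIdeal A))
    refine ⟨s, fun n => sup_le ?_ fun f hf k _ => hf k⟩
    -- A coefficient of degree `k` of an element of `𝔐ᵐ` lies in `𝔪ᵐ⁻ᵏ Iₖ`.
    have key : ∀ m, ∀ f ∈ F.reesMaximalIdeal ^ m, ∀ k,
        (f : Polynomial A).coeff k ∈ maximalIdeal A ^ (m - k) * F.ideal k := by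
      intro m
      induction m with
      | zero => intro f _ k; simpa using f.2 k
      | succ m ih =>
        intro f hf k
        rw [pow_succ'] at hf
        induction hf using Submodule.mul_induction_on' with
        | mem_mul_mem g hg f hf =>
          rw [MulMemClass.coe_mul, Polynomial.coeff_mul]
          refine Ideal.sum_mem _ fun p hp => ?_
          have hp' := Finset.HasAntidiagonal.mem_antidiagonal.mp hp
          have h1 := ih f hf p.2
          rcases Nat.eq_zero_or_pos p.1 with h0 | h0
          · have h2 := Ideal.mul_mem_mul ((mem_reesMaximalIdeal F g).mp hg) h1
            rw [← mul_assoc, ← pow_succ'] at h2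
            rw [h0, show k = p.2 by omega]
            exact Ideal.mul_mono_left (Ideal.pow_le_pow_right (by omega)) h2
          · have h2 := Ideal.mul_mem_mul (g.2 p.1) h1
            rw [mul_left_comm] at h2
            have h3 := Ideal.mul_mono_right (I := maximalIdeal A ^ (m - p.2))
              (F.ideal_mul_le p.1 p.2) h2
            rw [hp'] at h3
            exact Ideal.mul_mono_left (Ideal.pow_le_pow_right (by omega)) h3
        | add f _ g _ hf hg =>
          simpa using Ideal.add_mem _ hf hg
    intro f hf k hk
    exact Ideal.mul_mono_left ((Ideal.pow_le_pow_right (by omega)).trans hs) (key _ f hf k)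
  · obtain ⟨-, I, hI⟩ := hF
    obtain ⟨N, hN⟩ := hI.exists_ideal_add
    refine ⟨N, fun n f hf => F.mem_of_forall_reesMonomial_mem f fun k => ?_⟩
    rcases lt_or_ge k (n + N) with hk | hk
    · refine Ideal.mem_sup_right ?_
      rw [← fiberIdealModulo_bot, reesMonomial_mem_fiberIdealModulo]
      exact Ideal.mem_sup_right (hf k hk)
    · obtain ⟨j, rfl⟩ := Nat.exists_eq_add_of_le (show N ≤ k by omega)
      have h1 : (f : Polynomial A).coeff (N + j) ∈ I ^ j * F.ideal N := hN j ▸ f.2 (N + j)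
      obtain ⟨_, h2⟩ := reesMonomial_mem_pow hI.le_ideal_one
        (fun a ha => F.reesMonomial_mem_reesMaximalIdeal one_pos ⟨a, hI.le_ideal_one ha⟩) j N h1
      exact Ideal.mem_sup_left (Ideal.pow_le_pow_right (by omega) h2)

end IdealFiltration

/-! ### Growth of iterated sums -/

/-- A form of the Stolz–Cesàro theorem: if the differences of `f` grow like `c nᵈ`, then `f` grows
like `c nᵈ⁺¹ / (d + 1)`. -/
theorem tendsto_div_pow_succ_of_tendsto_sub {f : ℕ → ℝ} {c : ℝ} {d : ℕ}
    (h : Tendsto (fun n : ℕ => (f (n + 1) - f n) / ((n : ℝ) + 1) ^ d) atTop (𝓝 c)) :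
    Tendsto (fun n : ℕ => f n / (n : ℝ) ^ (d + 1)) atTop (𝓝 (c / (d + 1))) := by
  set g : ℕ → ℝ := fun k => ((k : ℝ) + 1) ^ (d + 1) - (k : ℝ) ^ (d + 1) with hg
  have hgpos : ∀ k, 0 < g k := fun k =>
    sub_pos.mpr (pow_lt_pow_left₀ (lt_add_one _) (Nat.cast_nonneg k) (Nat.succ_ne_zero d))
  have hsum : ∀ n, ∑ k ∈ Finset.range n, g k = (n : ℝ) ^ (d + 1) := fun n => by
    have := Finset.sum_range_sub (fun k : ℕ => (k : ℝ) ^ (d + 1)) n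
    simpa [hg] using this
  -- Factoring the difference of powers gives `g k / (k + 1)ᵈ → d + 1`.
  have hratio : Tendsto (fun k : ℕ => g k / ((k : ℝ) + 1) ^ d) atTop (𝓝 ((d : ℝ) + 1)) := by
    have h1 : ∀ k : ℕ, g k / ((k : ℝ) + 1) ^ d =
        ∑ i ∈ Finset.range (d + 1), ((k : ℝ) / ((k : ℝ) + 1)) ^ (d - i) := fun k => by
      have hk : (k : ℝ) + 1 ≠ 0 := by positivity
      have h2 := geom_sum₂_mul ((k : ℝ) + 1) (k : ℝ) (d + 1)
      rw [add_sub_cancel_left, mul_one] at h2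
      rw [hg]
      simp only
      rw [← h2, Finset.sum_div]
      refine Finset.sum_congr rfl fun i hi => ?_
      have hi' : i ≤ d := Nat.lt_succ_iff.mp (Finset.mem_range.mp hi)
      rw [div_pow, div_eq_div_iff (pow_ne_zero _ hk) (pow_ne_zero _ hk), Nat.add_sub_cancel,
        mul_right_comm, ← pow_add, Nat.add_sub_cancel' hi', mul_comm]
    simp_rw [h1]
    have h3 : ((d : ℝ) + 1) = ∑ i ∈ Finset.range (d + 1), (1 : ℝ) ^ (d - i) := by simp
    rw [h3]
    exact tendsto_finsetSum _ fun i _ => (tendsto_natCast_div_add_atTop (1 : ℝ)).pow _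
  have hd : (d : ℝ) + 1 ≠ 0 := by positivity
  have ho : (fun k => (f (k + 1) - f k) - c / (d + 1) * g k) =o[atTop] g := by
    rw [Asymptotics.isLittleO_iff_tendsto fun k hk => absurd hk (hgpos k).ne']
    have h4 := (h.div hratio hd).sub_const (c / (d + 1))
    rw [sub_self] at h4
    refine h4.congr fun k => ?_
    simp only [Pi.div_apply]
    have hk : ((k : ℝ) + 1) ^ d ≠ 0 := by positivity
    have := (hgpos k).ne'
    field_simp
  have ho' := ho.sum_range (fun k => (hgpos k).le) (by
    simp_rw [hsum]
    exact (tendsto_pow_atTop (Nat.succ_ne_zero d)).comp tendsto_natCast_atTop_atTop)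
  have hdiff : ∀ n, ∑ k ∈ Finset.range n, ((f (k + 1) - f k) - c / (d + 1) * g k) =
      f n - f 0 - c / (d + 1) * (n : ℝ) ^ (d + 1) := fun n => by
    rw [Finset.sum_sub_distrib, ← Finset.mul_sum, hsum, Finset.sum_range_sub]
  simp_rw [hdiff, hsum] at ho'
  have h5 := ho'.tendsto_div_nhds_zero
  have h6 : Tendsto (fun n : ℕ => f 0 / (n : ℝ) ^ (d + 1)) atTop (𝓝 0) :=
    tendsto_const_nhds.div_atTop
      ((tendsto_pow_atTop (Nat.succ_ne_zero d)).comp tendsto_natCast_atTop_atTop)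
  have h7 := (h5.add h6).add_const (c / ((d : ℝ) + 1))
  rw [add_zero, zero_add] at h7
  refine h7.congr' ?_
  filter_upwards [eventually_gt_atTop 0] with n hn
  have : (n : ℝ) ^ (d + 1) ≠ 0 := by positivity
  field_simp
  ring

theorem tendsto_comp_add_div_pow {f : ℕ → ℝ} {c : ℝ} {d : ℕ} (s : ℕ)
    (h : Tendsto (fun n : ℕ => f n / (n : ℝ) ^ d) atTop (𝓝 c)) :
    Tendsto (fun n : ℕ => f (n + s) / (n : ℝ) ^ d) atTop (𝓝 c) := by
  have h1 := ((tendsto_add_atTop_iff_nat s).mpr h).div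
    ((tendsto_natCast_div_add_atTop (s : ℝ)).pow d) (by simp)
  rw [one_pow, div_one] at h1
  refine h1.congr' ?_
  filter_upwards [eventually_gt_atTop 0] with n hn
  have h2 : (n : ℝ) ^ d ≠ 0 := by positivity
  have h3 : ((n : ℝ) + s) ^ d ≠ 0 := by positivity
  simp only [Pi.div_apply]
  push_cast
  rw [div_pow]
  field_simp

theorem tendsto_div_add_pow {f : ℕ → ℝ} {c : ℝ} {d : ℕ} (s : ℕ)
    (h : Tendsto (fun n : ℕ => f n / (n : ℝ) ^ d) atTop (𝓝 c)) :
    Tendsto (fun n : ℕ => f n / ((n : ℝ) + s) ^ d) atTop (𝓝 c) := by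
  have h1 := h.mul ((tendsto_natCast_div_add_atTop (s : ℝ)).pow d)
  rw [one_pow, mul_one] at h1
  refine h1.congr' ?_
  filter_upwards [eventually_gt_atTop 0] with n hn
  have h2 : (n : ℝ) ^ d ≠ 0 := by positivity
  have h3 : ((n : ℝ) + s) ^ d ≠ 0 := by positivity
  rw [div_pow]
  field_simp

/-- If the `i`-th member of a finite list of functions is, for large arguments, the difference
function of its predecessor, and the last member is eventually constant, then the leading
coefficients are determined by this constant. -/
theorem tendsto_div_pow_of_differences {e : ℝ} (d : ℕ) (h : ℕ → ℕ → ℝ)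
    (hd : ∀ᶠ n in atTop, h d n = e)
    (hstep : ∀ i < d, ∀ᶠ n in atTop, h i (n + 1) = h i n + h (i + 1) (n + 1)) :
    Tendsto (fun n : ℕ => h 0 n / (n : ℝ) ^ d) atTop (𝓝 (e / d.factorial)) := by
  induction d generalizing h with
  | zero =>
    refine (tendsto_const_nhds (x := e)).congr' ?_ |>.trans (by simp)
    filter_upwards [hd] with n hn
    simp [hn]
  | succ d ih =>
    have h1 := ih (fun i => h (i + 1)) hd fun i hi => hstep (i + 1) (by omega)
    have h2 : Tendsto (fun n : ℕ => (h 0 (n + 1) - h 0 n) / ((n : ℝ) + 1) ^ d) atTop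
        (𝓝 (e / d.factorial)) := by
      refine ((tendsto_add_atTop_iff_nat 1).mpr h1).congr' ?_
      filter_upwards [hstep 0 (by omega)] with n hn
      rw [hn, add_sub_cancel_left]
      push_cast
      rfl
    have h3 := tendsto_div_pow_succ_of_tendsto_sub h2
    rwa [div_div, mul_comm (d.factorial : ℝ), ← Nat.cast_succ, ← Nat.cast_mul,
      ← Nat.factorial_succ] at h3

/-! ### Multiplicity of the localized fiber cone -/

namespace IdealFiltration

variable {A : Type*} [CommRing A] [IsLocalRing A] [IsNoetherianRing A]

/-- The multiplicity of the localized fiber cone is read off from the growth of the Hilbert function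
of the fiber cone. -/
theorem hasHilbertSamuelMultiplicity_of_tendsto {J : Ideal A} (hJ : J.radical = maximalIdeal A)
    {F : IdealFiltration A} (hF : F.IsGood) {d e : ℕ}
    (hdim : ringKrullDim (LocalFiberCone hJ F) = ((d + 1 : ℕ) : WithBot ℕ∞))
    (h : Tendsto (fun n : ℕ => ((fiberLength J F ⊥ n).toNat : ℝ) / (n : ℝ) ^ d) atTop
      (𝓝 ((e : ℝ) / d.factorial))) :
    HasHilbertSamuelMultiplicity (LocalFiberCone hJ F) e := by
  obtain ⟨⟨s, hs⟩, N, hN⟩ := exists_reesMaximalIdeal_pow_le hJ hF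
  set L : ℕ → ℕ∞ := fun n => Module.length (LocalFiberCone hJ F)
    (LocalFiberCone hJ F ⧸ maximalIdeal (LocalFiberCone hJ F) ^ n) with hL
  set H : ℕ → ℕ∞ := fun n => ∑ k ∈ Finset.range n, fiberLength J F ⊥ k with hH
  have hHtop : ∀ n, H n ≠ ⊤ := fun n => by
    simpa [hH, ENat.sum_eq_top] using fun k _ => fiberLength_ne_top hJ F ⊥ k
  have hmono : ∀ {K K' : Ideal F.rees}, K ≤ K' →
      Module.length A (F.rees ⧸ K') ≤ Module.length A (F.rees ⧸ K) := fun hK =>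
    Module.length_le_of_surjective ((Submodule.factor hK).restrictScalars A)
      (Submodule.factor_surjective hK)
  have hlow : ∀ n, H n ≤ L (n + s) := fun n => by
    rw [hL, hH]
    simp only
    rw [length_localFiberCone_quotient_pow, ← length_rees_quotient_fiberIdealBelow]
    exact hmono (hs n)
  have hupp : ∀ n, L n ≤ H (n + N) := fun n => by
    rw [hL, hH]
    simp only
    rw [length_localFiberCone_quotient_pow, ← length_rees_quotient_fiberIdealBelow]
    exact hmono (hN n)
  have hLtop : ∀ n, L n ≠ ⊤ := fun n => ne_top_of_le_ne_top (hHtop _) (hupp n)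
  have hHlim : Tendsto (fun n : ℕ => ((H n).toNat : ℝ) / (n : ℝ) ^ (d + 1)) atTop
      (𝓝 ((e : ℝ) / (d + 1).factorial)) := by
    have h1 : ∀ n, ((H (n + 1)).toNat : ℝ) - ((H n).toNat : ℝ) =
        ((fiberLength J F ⊥ n).toNat : ℝ) := fun n => by
      have : H (n + 1) = H n + fiberLength J F ⊥ n := Finset.sum_range_succ _ _
      rw [this, ENat.toNat_add (hHtop n) (fiberLength_ne_top hJ F ⊥ n)]
      push_cast
      ring
    have h2 := tendsto_div_pow_succ_of_tendsto_sub (f := fun n => ((H n).toNat : ℝ))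
      (c := (e : ℝ) / d.factorial) (d := d) (by
        simp_rw [h1]
        exact_mod_cast tendsto_div_add_pow 1 h)
    rwa [div_div, mul_comm (d.factorial : ℝ), ← Nat.cast_succ, ← Nat.cast_mul,
      ← Nat.factorial_succ] at h2
  have hLlim : Tendsto (fun n : ℕ => ((L n).toNat : ℝ) / (n : ℝ) ^ (d + 1)) atTop
      (𝓝 ((e : ℝ) / (d + 1).factorial)) := by
    rw [← tendsto_add_atTop_iff_nat s]
    refine tendsto_of_tendsto_of_tendsto_of_le_of_le (tendsto_div_add_pow s hHlim)
      ((tendsto_add_atTop_iff_nat s).mpr (tendsto_comp_add_div_pow N hHlim)) (fun n => ?_)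
      (fun n => ?_)
    · simp only
      push_cast
      exact div_le_div_of_nonneg_right
        (Nat.cast_le.mpr (ENat.toNat_le_toNat (hlow n) (hLtop _))) (by positivity)
    · simp only
      exact div_le_div_of_nonneg_right
        (Nat.cast_le.mpr (ENat.toNat_le_toNat (hupp _) (hHtop _))) (by positivity)
  refine ⟨d + 1, hdim, hLtop, ?_⟩
  have h3 := hLlim.const_mul ((d + 1).factorial : ℝ)
  rw [mul_div_cancel₀ _ (by positivity)] at h3
  simpa only [mul_div_assoc] using h3

end IdealFiltration

open IdealFiltration in
theorem theorem3p3 {A : Type*} [CommRing A] [IsLocalRing A] [IsNoetherianRing A]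
    [Infinite (ResidueField A)]
    (J : Ideal A) (hJ : J.radical = maximalIdeal A)
    (F : IdealFiltration A) (hF : F.IsGood)
    (l : ℕ) (hl : F.analyticSpread = (l : WithBot ℕ∞)) (hpos : 0 < l)
    (x : Fin l → A) (hx : IdealFiltration.IsWeakFCSequence J F x) :
    IdealFiltration.IsReduction (Ideal.span (Set.range x)) F ∧
    ∃ e : ℕ, HasHilbertSamuelMultiplicity (IdealFiltration.LocalFiberCone hJ F) e ∧
      ∀ n ≥ IdealFiltration.reductionNumber (Ideal.span (Set.range x)) F,
        Module.length A
          (F.ideal n ⧸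
            ((idealSaturation (IdealFiltration.initialIdeal x (l - 1)) (F.ideal 1) ⊓ F.ideal n)
              ⊔ J * F.ideal n).submoduleOf (F.ideal n)) = (e : ℕ∞) := by
  have hred := hx.isReduction hJ hF hl
  refine ⟨hred, ?_⟩
  obtain ⟨d, rfl⟩ : ∃ d, l = d + 1 := ⟨l - 1, by omega⟩
  obtain ⟨hdim, -⟩ := hx.ringKrullDim_localFiberCone hJ hF hl
  simp only [length_quotient_inf_sup_mul, Nat.add_sub_cancel]
  set 𝔔 := Ideal.span (Set.range x) with h𝔔
  set Q := initialIdeal x d with hQ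
  have hlast : IsWeakFCModulo J F Q (x (Fin.last d)) := hx.modulo (Fin.last d)
  have hsplit : Q ⊔ Ideal.span {x (Fin.last d)} = 𝔔 := by
    rw [h𝔔, ← initialIdeal_self]
    exact (initialIdeal_succ x (Fin.last d)).symm
  have hr : ∀ n ≥ reductionNumber 𝔔 F, 𝔔 * F.ideal n = F.ideal (n + 1) := by
    obtain ⟨M, hM⟩ := hred.2
    exact Nat.sInf_mem (s := {r : ℕ | ∀ n ≥ r, 𝔔 * F.ideal n = F.ideal (n + 1)})
      ⟨M, fun n hn => (hM n hn).symm⟩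
  set B := idealSaturation Q (F.ideal 1)
  -- From the reduction number on, the length does not depend on `n`.
  have hconst : ∀ n ≥ reductionNumber 𝔔 F,
      fiberLength J F B n = fiberLength J F B (reductionNumber 𝔔 F) := by
    intro n hn
    induction n, hn using Nat.le_induction with
    | base => rfl
    | succ n hn ih =>
      rw [← ih]
      exact hlast.fiberLength_saturation_succ (by rw [hsplit]; exact hr n hn)
  obtain ⟨e, he⟩ := ENat.ne_top_iff_exists.mp (fiberLength_ne_top hJ F B (reductionNumber 𝔔 F))
  refine ⟨e, ?_, fun n hn => (hconst n hn).trans he.symm⟩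
  refine hasHilbertSamuelMultiplicity_of_tendsto hJ hF hdim ?_
  have hlim := tendsto_div_pow_of_differences (e := e) d
    (fun i n => ((fiberLength J F (initialIdeal x i) n).toNat : ℝ)) ?_ ?_
  · simpa only [initialIdeal_zero] using hlim
  -- In large degrees `(Q : I₁^∞) ∩ Iₙ = Q ∩ Iₙ`, so the common value is the Hilbert function of the
  -- fiber cone of `F / Q`.
  · obtain ⟨M, hM⟩ := exists_idealSaturation_inf_le hF Q
    filter_upwards [eventually_ge_atTop (max M (reductionNumber 𝔔 F))] with n hn
    have h1 : fiberLength J F Q n = fiberLength J F B n :=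
      fiberLength_congr (le_antisymm (inf_le_inf_right _ (le_idealSaturation Q _))
        (le_inf (hM n (le_of_max_le_left hn)) inf_le_right))
    rw [← hQ, h1, hconst n (le_of_max_le_right hn), ← he, ENat.toNat_natCast]
  · intro i hi
    obtain ⟨M, hM⟩ := (hx.modulo ⟨i, by omega⟩).exists_fiberLength_succ hF
    filter_upwards [eventually_ge_atTop M] with n hn
    have h1 := hM n hn
    rw [← initialIdeal_succ x ⟨i, by omega⟩] at h1
    simp only at h1
    rw [h1, ENat.toNat_add (fiberLength_ne_top hJ F _ _) (fiberLength_ne_top hJ F _ _)]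
    push_cast
    rfl
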